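/- Let $\mathfrak K$ be a field, let $\Gamma$ be a finite quiver without oriented cycles, and let $\Lambda=\mathfrak K\Gamma/I$, where $I$ is an admissible ideal of the path algebra generated by paths (so $\Lambda$ is a triangular monomial algebra). Paths are composed from right to left, $s(\cdot)$ and $t(\cdot)$ denote start and end points, and $J$ is the Jacobson radical of $\Lambda$. Let $U$ be a finitely generated uniserial left $\Lambda$-module (one with exactly one composition series), of length $n$, with mast $$p=\alpha_{n-1}\cdots\alpha_1,\qquad 1\xrightarrow{\alpha_1}2\xrightarrow{\alpha_2}\cdots\xrightarrow{\alpha_{n-1}}n,$$ that is, $p$ is a path of length $n-1$ in $\Gamma$ with $pU\neq 0$; its (pairwise distinct) vertices are labelled $1,\dots,n$. An empty product of the $\alpha_i$ stands for the trivial path at the vertex in question. Define the following sets of arrows of $\Gamma$: - $B$: the arrows $\beta$ with $s(\beta)\in\{1,\dots,n-1\}$ and $t(\beta)\notin\{1,\dots,n\}$; - $B'$: the arrows $\beta'$ with $s(\beta')=n$; - $C$: the arrows $\gamma$ with $s(\gamma)\notin\{1,\dots,n\}$ and $t(\gamma)\in\{2,\dots,n\}$; - $D$: the arrows $\delta\notin\{\alpha_1,\dots,\alpha_{n-1}\}$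 with $s(\delta),t(\delta)\in\{1,\dots,n\}$. Call a homomorphism $f$ of finitely generated left $\Lambda$-modules irreducible if it is neither a split monomorphism nor a split epimorphism and, whenever $f=hg$ with $g,h$ homomorphisms of finitely generated left $\Lambda$-modules, $g$ is a split monomorphism or $h$ is a split epimorphism. Then the following statements are equivalent: (1) The embedding $JU\hookrightarrow U$ is irreducible. (2) $U$ is not simple, and both (a) and (b) hold (all equations in $\Lambda$): (a) (i) $\beta\,\alpha_{s(\beta)-1}\cdots\alpha_1=0$ for every $\beta\in B$, and (ii) $\delta\,\alpha_{s(\delta)-1}\cdots\alpha_1=0$ for every $\delta\in D$. (b) For every $\beta'\in B'$ with $\beta'p\neq 0$: (i) $\beta'\alpha_{n-1}\cdots\alpha_{t(\gamma)}\gamma=0$ for every $\gamma\in C$, and (ii) $\beta'\alpha_{n-1}\cdots\alpha_{t(\delta)}\delta=0$ for every $\delta\in D$. -/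

import Mathlib

universe u v w x

noncomputable section

open Quiver

/-! ### The path algebra of a finite quiver -/

/-- The path algebra `K Γ` of a quiver with finitely many vertices: an element is a finitely
supported family of coefficients on the paths `a → b`, for each pair of vertices `a`, `b`. -/
def PathAlgebra (K : Type u) (Γ : Type v) [Field K] [Quiver.{w} Γ] : Type (max u v w) :=
  ∀ a b : Γ, Path a b →₀ K

namespace PathAlgebra

section Basic

variable {K : Type u} {Γ : Type v} [Field K] [Quiver.{w} Γ]

instance : AddCommGroup (PathAlgebra K Γ) :=
  inferInstanceAs (AddCommGroup (∀ a b : Γ, Path a b →₀ K))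

instance : Module K (PathAlgebra K Γ) :=
  inferInstanceAs (Module K (∀ a b : Γ, Path a b →₀ K))

@[ext]
theorem ext {f g : PathAlgebra K Γ} (h : ∀ a b, f a b = g a b) : f = g :=
  funext fun a => funext fun b => h a b

@[simp] theorem add_apply (f g : PathAlgebra K Γ) (a b : Γ) : (f + g) a b = f a b + g a b := rfl

@[simp] theorem zero_apply (a b : Γ) : (0 : PathAlgebra K Γ) a b = 0 := rfl

@[simp] theorem smul_apply (k : K) (f : PathAlgebra K Γ) (a b : Γ) : (k • f) a b = k • f a b := rfl

/-- The bilinear extension of concatenation of paths: `(q, p) ↦ qp` ("first `p`, then `q`"). -/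
def concat (a c b : Γ) : (Path c b →₀ K) →ₗ[K] (Path a c →₀ K) →ₗ[K] (Path a b →₀ K) :=
  Finsupp.linearCombination K fun q : Path c b =>
    Finsupp.lmapDomain K K fun p : Path a c => p.comp q

@[simp]
theorem concat_single {a c b : Γ} (q : Path c b) (p : Path a c) (s t : K) :
    concat a c b (Finsupp.single q s) (Finsupp.single p t)
      = Finsupp.single (p.comp q) (s * t) := by
  simp [concat, Finsupp.linearCombination_single, Finsupp.mapDomain_single]

theorem concat_assoc {a b c d : Γ} (h : Path c d →₀ K) (g : Path b c →₀ K) (f : Path a b →₀ K) :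
    concat a b d (concat b c d h g) f = concat a c d h (concat a b c g f) := by
  induction h using Finsupp.induction_linear with
  | zero => simp
  | add h₁ h₂ e₁ e₂ => simp [e₁, e₂]
  | single r k =>
    induction g using Finsupp.induction_linear with
    | zero => simp
    | add g₁ g₂ e₁ e₂ => simp [e₁, e₂]
    | single q l =>
      induction f using Finsupp.induction_linear with
      | zero => simp
      | add f₁ f₂ e₁ e₂ => simp only [map_add, e₁, e₂]
      | single p m => simp only [concat_single, mul_assoc, Path.comp_assoc]

theorem concat_nil_left {a b : Γ} (f : Path a b →₀ K) :
    concat a b b (Finsupp.single Path.nil 1) f = f := by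
  induction f using Finsupp.induction_linear with
  | zero => simp
  | add f₁ f₂ e₁ e₂ => simp [e₁, e₂]
  | single p m => simp

theorem concat_nil_right {a b : Γ} (f : Path a b →₀ K) :
    concat a a b f (Finsupp.single Path.nil 1) = f := by
  induction f using Finsupp.induction_linear with
  | zero => simp
  | add f₁ f₂ e₁ e₂ => simp [e₁, e₂]
  | single p m => simp

/-- The product, in which paths are composed from right to left. -/
instance [Fintype Γ] : Mul (PathAlgebra K Γ) :=
  ⟨fun f g a b => ∑ c, concat a c b (f c b) (g a c)⟩

theorem mul_apply [Fintype Γ] (f g : PathAlgebra K Γ) (a b : Γ) :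
    (f * g) a b = ∑ c, concat a c b (f c b) (g a c) := rfl

theorem sum_apply {ι : Type*} (s : Finset ι) (F : ι → PathAlgebra K Γ) (a b : Γ) :
    (∑ i ∈ s, F i) a b = ∑ i ∈ s, F i a b := by
  induction s using Finset.cons_induction with
  | empty => simp
  | cons i s hi ih => simp [Finset.sum_cons, ih]

end Basic

section Ring

variable {K : Type u} {Γ : Type v} [Field K] [Quiver.{w} Γ] [DecidableEq Γ]

/-- A path of `Γ`, as an element of the path algebra. -/
def ofPath (K : Type u) {Γ : Type v} [Field K] [Quiver.{w} Γ] [DecidableEq Γ] {a b : Γ}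
    (p : Path a b) : PathAlgebra K Γ :=
  Pi.single a (Pi.single b (Finsupp.single p 1))

theorem ofPath_apply_self {a b : Γ} (p : Path a b) : ofPath K p a b = Finsupp.single p 1 := by
  simp [ofPath]

theorem ofPath_apply_of_source_ne {a b a' b' : Γ} (p : Path a b) (h : a' ≠ a) :
    ofPath K p a' b' = 0 := by
  simp [ofPath, Pi.single_eq_of_ne h]

theorem ofPath_apply_of_target_ne {a b a' b' : Γ} (p : Path a b) (h : b' ≠ b) :
    ofPath K p a' b' = 0 := by
  by_cases ha : a' = a
  · subst ha
    simp [ofPath, Pi.single_eq_of_ne h]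
  · exact ofPath_apply_of_source_ne p ha

variable [Fintype Γ]

/-- The unit is the sum of the trivial paths. -/
instance : One (PathAlgebra K Γ) := ⟨∑ a : Γ, ofPath K (Path.nil : Path a a)⟩

theorem one_def : (1 : PathAlgebra K Γ) = ∑ a : Γ, ofPath K (Path.nil : Path a a) := rfl

theorem one_apply_self (a : Γ) : (1 : PathAlgebra K Γ) a a = Finsupp.single Path.nil 1 := by
  rw [one_def, sum_apply, Finset.sum_eq_single a]
  · exact ofPath_apply_self _
  · intro b _ hb
    exact ofPath_apply_of_source_ne _ hb.symm
  · simp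

theorem one_apply_ne {a b : Γ} (h : a ≠ b) : (1 : PathAlgebra K Γ) a b = 0 := by
  rw [one_def, sum_apply]
  refine Finset.sum_eq_zero fun c _ => ?_
  by_cases hc : a = c
  · exact ofPath_apply_of_target_ne _ fun hb => h (hc.trans hb.symm)
  · exact ofPath_apply_of_source_ne _ hc

instance : Ring (PathAlgebra K Γ) :=
  { (inferInstance : AddCommGroup (PathAlgebra K Γ)) with
    mul := (· * ·)
    one := 1
    zero_mul := fun f => by ext1 a b; simp [mul_apply]
    mul_zero := fun f => by ext1 a b; simp [mul_apply]
    left_distrib := fun f g h => by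
      ext1 a b; simp [mul_apply, Finset.sum_add_distrib]
    right_distrib := fun f g h => by
      ext1 a b; simp [mul_apply, Finset.sum_add_distrib]
    mul_assoc := fun f g h => by
      ext1 a b
      simp only [mul_apply, map_sum, LinearMap.sum_apply]
      rw [Finset.sum_comm]
      simp only [concat_assoc]
    one_mul := fun f => by
      ext1 a b
      rw [mul_apply, Finset.sum_eq_single b]
      · rw [one_apply_self, concat_nil_left]
      · intro c _ hc
        rw [one_apply_ne hc]; simp
      · simp
    mul_one := fun f => by
      ext1 a b
      rw [mul_apply, Finset.sum_eq_single a]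
      · rw [one_apply_self, concat_nil_right]
      · intro c _ hc
        rw [one_apply_ne hc.symm]; simp
      · simp }

instance : Algebra K (PathAlgebra K Γ) :=
  Algebra.ofModule
    (fun k f g => by ext1 a b; simp [mul_apply, Finset.smul_sum])
    (fun k f g => by ext1 a b; simp [mul_apply, Finset.smul_sum])

/-- Products are composed from right to left: `q * p` is the path `p` followed by `q`. -/
theorem ofPath_mul_ofPath {a b c : Γ} (q : Path b c) (p : Path a b) :
    ofPath K q * ofPath K p = ofPath K (p.comp q) := by
  ext1 x y
  rw [mul_apply, Finset.sum_eq_single b]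
  · by_cases hx : x = a
    · subst hx
      by_cases hy : y = c
      · subst hy
        simp [ofPath_apply_self]
      · simp [ofPath_apply_of_target_ne _ hy]
    · simp [ofPath_apply_of_source_ne _ hx]
  · intro z _ hz
    simp [ofPath_apply_of_source_ne _ hz]
  · simp

theorem ofPath_mul_ofPath_of_ne {a b c d : Γ} (q : Path c d) (p : Path a b) (h : b ≠ c) :
    ofPath K q * ofPath K p = 0 := by
  ext1 x y
  rw [mul_apply]
  refine Finset.sum_eq_zero fun z _ => ?_
  by_cases hz : z = c
  · subst hz
    simp [ofPath_apply_of_target_ne p h.symm]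
  · simp [ofPath_apply_of_source_ne q hz]

end Ring

end PathAlgebra

/-! ### Bound quiver algebras -/

section BoundQuiver

variable {K : Type u} {Γ : Type v} [Field K] [Quiver.{w} Γ] [DecidableEq Γ] [Fintype Γ]

/-- The quiver has no oriented cycles. -/
def IsTriangularQuiver (Γ : Type v) [Quiver.{w} Γ] : Prop :=
  ∀ (a : Γ) (c : Path a a), c = Path.nil

/-- The `m`-th power of the ideal generated by the arrows, i.e. the ideal generated by
all paths of length at least `m`. -/
def arrowIdealPow (K : Type u) (Γ : Type v) [Field K] [Quiver.{w} Γ] [DecidableEq Γ] [Fintype Γ]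
    (m : ℕ) : TwoSidedIdeal (PathAlgebra K Γ) :=
  TwoSidedIdeal.span {f | ∃ (a b : Γ) (p : Path a b), m ≤ p.length ∧ f = PathAlgebra.ofPath K p}

/-- `I` is admissible: it contains some power of the arrow ideal and is contained in
its square. -/
def IsAdmissibleIdeal (I : TwoSidedIdeal (PathAlgebra K Γ)) : Prop :=
  (∃ m : ℕ, arrowIdealPow K Γ m ≤ I) ∧ I ≤ arrowIdealPow K Γ 2

/-- `I` is monomial: it is generated by a set of paths. -/
def IsMonomialIdeal (I : TwoSidedIdeal (PathAlgebra K Γ)) : Prop :=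
  ∃ S : Set (Σ a b : Γ, Path a b),
    I = TwoSidedIdeal.span ((fun s => PathAlgebra.ofPath K s.2.2) '' S)

/-- The algebra `Λ = K Γ / I`. -/
abbrev BoundQuiverAlgebra (I : TwoSidedIdeal (PathAlgebra K Γ)) : Type (max u v w) :=
  I.ringCon.Quotient

/-- The class in `Λ = K Γ / I` of a path of `Γ`. -/
def pathClass (I : TwoSidedIdeal (PathAlgebra K Γ)) {a b : Γ} (p : Path a b) :
    BoundQuiverAlgebra I :=
  I.ringCon.mk' (PathAlgebra.ofPath K p)

/-- The class in `Λ = K Γ / I` of an arrow of `Γ`. -/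
def arrowClass (I : TwoSidedIdeal (PathAlgebra K Γ)) {a b : Γ} (α : a ⟶ b) :
    BoundQuiverAlgebra I :=
  pathClass I α.toPath

/-- `p` is a mast of `U`: `U` has finite length `n = length p + 1` and `p x ≠ 0` for
some `x ∈ U`. -/
def IsMast (I : TwoSidedIdeal (PathAlgebra K Γ)) (U : Type x) [AddCommGroup U]
    [Module (BoundQuiverAlgebra I) U] {a b : Γ} (p : Path a b) : Prop :=
  Module.length (BoundQuiverAlgebra I) U = (p.length : ℕ∞) + 1 ∧
    ∃ x : U, pathClass I p • x ≠ 0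

end BoundQuiver

/-! ### Arrows touching a path

`p : Path a b` runs from its first vertex `a` to its last vertex `b`; `p.vertices` lists all the
vertices it passes through (they are distinct if the quiver has no oriented cycles). -/

section Touching

variable {Γ : Type v} [Quiver.{w} Γ] {a b : Γ}

/-- `u` is a right subpath of `p`, `p = r u`: an initial segment. In a quiver without
oriented cycles there is exactly one right subpath of `p` ending in a given vertex of `p`. -/
def IsRightSubpath {x : Γ} (u : Path a x) (p : Path a b) : Prop :=
  ∃ r : Path x b, p = u.comp r

/-- `r` is a left subpath of `p`, `p = r u`: a terminal segment. In a quiver without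
oriented cycles there is exactly one left subpath of `p` starting in a given vertex of `p`. -/
def IsLeftSubpath {x : Γ} (r : Path x b) (p : Path a b) : Prop :=
  ∃ u : Path a x, p = u.comp r

/-- `α` is one of the arrows of `p`. -/
def IsArrowOf {x y : Γ} (α : x ⟶ y) (p : Path a b) : Prop :=
  ∃ (u : Path a x) (r : Path y b), p = (u.cons α).comp r

/-- The class `B`: arrows from a vertex of `p` other than the last one to a vertex off `p`. -/
def IsB (p : Path a b) {x y : Γ} (_β : x ⟶ y) : Prop :=
  x ∈ p.vertices ∧ x ≠ b ∧ y ∉ p.vertices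

/-- The class `B'`: arrows starting in the last vertex of `p`. -/
def IsB' (_p : Path a b) {x y : Γ} (_β : x ⟶ y) : Prop :=
  x = b

/-- The class `C`: arrows from a vertex off `p` to a vertex of `p` other than the first one. -/
def IsC (p : Path a b) {x y : Γ} (_γ : x ⟶ y) : Prop :=
  x ∉ p.vertices ∧ y ∈ p.vertices ∧ y ≠ a

/-- The class `D`: arrows between vertices of `p` which are not arrows of `p`. -/
def IsD (p : Path a b) {x y : Γ} (δ : x ⟶ y) : Prop :=
  x ∈ p.vertices ∧ y ∈ p.vertices ∧ ¬ IsArrowOf δ p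

end Touching

/-! ### Modules -/

section Modules

/-- A uniserial module: it has exactly one composition series. -/
def IsUniserialModule (R : Type u) (U : Type x) [Ring R] [AddCommGroup U] [Module R U] : Prop :=
  ∃! s : CompositionSeries (Submodule R U), s.head = ⊥ ∧ s.last = ⊤

variable {R : Type u} [Ring R] {M N : Type x} [AddCommGroup M] [Module R M] [AddCommGroup N]
  [Module R N]

/-- `f` has a left inverse. -/
def IsSplitMonoHom (f : M →ₗ[R] N) : Prop := ∃ g : N →ₗ[R] M, g ∘ₗ f = LinearMap.id

/-- `f` has a right inverse. -/
def IsSplitEpiHom (f : M →ₗ[R] N) : Prop := ∃ g : N →ₗ[R] M, f ∘ₗ g = LinearMap.id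

/-- `f` is irreducible in the category of finitely generated `R`-modules: it is neither a split
monomorphism nor a split epimorphism, and in every factorization `f = h g` through a finitely
generated module, `g` is a split monomorphism or `h` is a split epimorphism. -/
def IsIrreducibleHom (f : M →ₗ[R] N) : Prop :=
  ¬ IsSplitMonoHom f ∧ ¬ IsSplitEpiHom f ∧
    ∀ (V : Type x) [AddCommGroup V] [Module R V] [Module.Finite R V]
      (g : M →ₗ[R] V) (h : V →ₗ[R] N), h ∘ₗ g = f → IsSplitMonoHom g ∨ IsSplitEpiHom h

/-- The submodule `JU`, where `J` is the Jacobson radical of `R`. -/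
def radSubmodule (R : Type u) (U : Type x) [Ring R] [AddCommGroup U] [Module R U] :
    Submodule R U :=
  Ring.jacobson R • (⊤ : Submodule R U)

end Modules

end

/-! The vertices of p are distinct and simple modules are one-dimensional over K, so U has a K-basis
consisting of the products of the right subpaths of p with one vector x₀ at the first vertex a
(`mastBasis`). The radical JU has no component at a.

Necessity. For r in Λ annihilating JU, the embedding factors through V = (JU × Λ × Λ)/Λ(p x₀, -p,
-r), where V → U is the inclusion on JU, evaluation at x₀ on the first Λ and zero on the second. The
map JU → V has no retraction, because p and r annihilate JU while p x₀ ≠ 0. So V → U has a section,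
which turns each relation c x₀ = 0 at a into c = d p and c s = d r, with s independent of c
(`exists_factor_of_isIrreducibleHom`). Taking r = 0 gives (a). Given (a), an r of the form (left
subpath)·ε and the relation c = β'p give (b). Both times the coefficient of a single path is
compared; this is legitimate because a monomial ideal contains every path occurring in its elements.

Sufficiency. By (a), arrows off the mast annihilate U, so a vector of V at a on which every β'p
vanishes defines a map U → V. Dually, a functional on V vanishing on pV and on the span N of the
spaces (left subpath)·ε V, with ε off the mast, defines a map V → JU. Given a factorization h g of
the embedding, put z = g(p x₀). If z ∈ pV + N, then (b) supplies a section of h; otherwise a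
functional separating z from pV + N supplies a retraction of g (`isSplitMonoHom_or_isSplitEpiHom`).
-/

open Quiver

/-! ### Coefficients of paths in the path algebra -/

namespace PathAlgebra

section Coefficients

variable {K : Type u} {Γ : Type v} [Field K] [Quiver.{w} Γ]

@[simp] theorem sub_apply (f g : PathAlgebra K Γ) (a b : Γ) : (f - g) a b = f a b - g a b := rfl

theorem exists_of_concat_apply_ne_zero {a c b : Γ} {f : Path c b →₀ K} {g : Path a c →₀ K}
    {q : Path a b} (h : concat a c b f g q ≠ 0) :
    ∃ (r : Path c b) (s : Path a c), f r ≠ 0 ∧ g s ≠ 0 ∧ q = s.comp r := by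
  classical
  rw [concat, Finsupp.linearCombination_apply, Finsupp.sum, LinearMap.sum_apply,
    Finsupp.finsetSum_apply] at h
  obtain ⟨r, hr, h⟩ := Finset.exists_ne_zero_of_sum_ne_zero h
  rw [LinearMap.smul_apply, Finsupp.smul_apply, Finsupp.lmapDomain_apply] at h
  have h' := Finsupp.mapDomain_support (Finsupp.mem_support_iff.2 (right_ne_zero_of_smul h))
  obtain ⟨s, hs, rfl⟩ := Finset.mem_image.1 h'
  exact ⟨r, s, Finsupp.mem_support_iff.1 hr, Finsupp.mem_support_iff.1 hs, rfl⟩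

theorem exists_of_mul_apply_ne_zero [Fintype Γ] {f g : PathAlgebra K Γ} {a b : Γ}
    {q : Path a b} (h : (f * g) a b q ≠ 0) :
    ∃ (c : Γ) (r : Path c b) (s : Path a c), f c b r ≠ 0 ∧ g a c s ≠ 0 ∧ q = s.comp r := by
  rw [mul_apply, Finsupp.finsetSum_apply] at h
  obtain ⟨c, -, h⟩ := Finset.exists_ne_zero_of_sum_ne_zero h
  exact ⟨c, exists_of_concat_apply_ne_zero h⟩

variable [DecidableEq Γ]

/-- The equality is stated in the sigma type so that `cases` can identify endpoints and path at
once. -/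
theorem ofPath_apply_ne_zero {a b a' b' : Γ} {p : Path a b} {q : Path a' b'}
    (h : ofPath K p a' b' q ≠ 0) : (⟨a, b, p⟩ : Σ a b : Γ, Path a b) = ⟨a', b', q⟩ := by
  by_cases ha : a' = a
  · subst ha
    by_cases hb : b' = b
    · subst hb
      rw [ofPath_apply_self] at h
      rw [← (Finsupp.single_apply_ne_zero.1 h).1]
    · exact absurd (by rw [ofPath_apply_of_target_ne _ hb]; rfl) h
  · exact absurd (by rw [ofPath_apply_of_source_ne _ ha]; rfl) h

theorem ofPath_apply_path {a b : Γ} (p : Path a b) : ofPath K p a b p = 1 := by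
  simp [ofPath_apply_self]

theorem ofPath_apply_of_ne {a b : Γ} {p q : Path a b} (h : p ≠ q) : ofPath K p a b q = 0 := by
  by_contra h'
  simpa [h] using ofPath_apply_ne_zero h'

/-- The path algebra is spanned by the paths. -/
theorem induction_ofPath [Fintype Γ] {P : PathAlgebra K Γ → Prop} (f : PathAlgebra K Γ)
    (zero : P 0) (add : ∀ f g, P f → P g → P (f + g))
    (smul_path : ∀ (a b : Γ) (p : Path a b) (k : K), f a b p ≠ 0 → P (k • ofPath K p)) : P f := by
  have hf : f = ∑ a, ∑ b, ∑ q ∈ (f a b).support, f a b q • ofPath K q := by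
    ext1 a b
    rw [sum_apply, Finset.sum_eq_single a, sum_apply, Finset.sum_eq_single b, sum_apply]
    · conv_lhs => rw [← Finsupp.sum_single (f a b)]
      refine Finset.sum_congr rfl fun q _ => ?_
      rw [smul_apply, ofPath_apply_self, Finsupp.smul_single, smul_eq_mul, mul_one]
    · intro c _ hc
      rw [sum_apply]
      refine Finset.sum_eq_zero fun q _ => ?_
      rw [smul_apply, ofPath_apply_of_target_ne _ hc.symm, smul_zero]
    · simp
    · intro c _ hc
      rw [sum_apply]
      refine Finset.sum_eq_zero fun d _ => ?_
      rw [sum_apply]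
      refine Finset.sum_eq_zero fun q _ => ?_
      rw [smul_apply, ofPath_apply_of_source_ne _ hc.symm, smul_zero]
    · simp
  rw [hf]
  refine Finset.sum_induction _ P add zero fun a _ => Finset.sum_induction _ P add zero
    fun b _ => Finset.sum_induction _ P add zero fun q hq => ?_
  exact smul_path a b q _ (Finsupp.mem_support_iff.1 hq)

variable [Fintype Γ]

/-- Precomposition with p is injective on paths, so distinct terms of f never merge. -/
theorem mul_ofPath_apply_comp {a b c : Γ} (f : PathAlgebra K Γ) (p : Path a b) (q : Path b c) :
    (f * ofPath K p) a c (p.comp q) = f b c q := by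
  rw [mul_apply, Finsupp.finsetSum_apply, Finset.sum_eq_single b]
  · rw [ofPath_apply_self]
    induction f b c using Finsupp.induction_linear with
    | zero => simp
    | add g h hg hh => simp [hg, hh]
    | single r k =>
      rw [concat_single, mul_one]
      by_cases h : r = q
      · subst h; simp
      · rw [Finsupp.single_eq_of_ne (Ne.symm h), Finsupp.single_eq_of_ne]
        exact fun h' => h (Path.comp_injective_right p h').symm
  · intro d _ hd
    rw [ofPath_apply_of_target_ne _ hd, map_zero]; rfl
  · simp

theorem exists_of_mul_ofPath_apply_ne_zero {a b c : Γ} {f : PathAlgebra K Γ} {p : Path a b}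
    {q : Path a c} (h : (f * ofPath K p) a c q ≠ 0) : ∃ s : Path b c, q = p.comp s := by
  obtain ⟨d, r, s, -, hs, rfl⟩ := exists_of_mul_apply_ne_zero h
  cases ofPath_apply_ne_zero hs
  exact ⟨r, rfl⟩

theorem exists_of_ofPath_mul_apply_ne_zero {a b c : Γ} {f : PathAlgebra K Γ} {p : Path a b}
    {q : Path c b} (h : (ofPath K p * f) c b q ≠ 0) : ∃ s : Path c a, q = s.comp p := by
  obtain ⟨d, r, s, hr, -, rfl⟩ := exists_of_mul_apply_ne_zero h
  cases ofPath_apply_ne_zero hr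
  exact ⟨s, rfl⟩

end Coefficients

end PathAlgebra

/-! ### Bound quiver algebras and monomial ideals -/

section BoundQuiver

open PathAlgebra

variable {K : Type u} {Γ : Type v} [Field K] [Quiver.{w} Γ] [DecidableEq Γ] [Fintype Γ]
  {I : TwoSidedIdeal (PathAlgebra K Γ)}

theorem boundQuiver_mk_eq_zero_iff {f : PathAlgebra K Γ} : I.ringCon.mk' f = 0 ↔ f ∈ I := by
  rw [TwoSidedIdeal.mem_iff, ← map_zero I.ringCon.mk']
  exact I.ringCon.eq

theorem boundQuiver_mk_smul (k : K) (f : PathAlgebra K Γ) :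
    I.ringCon.mk' (k • f) = k • I.ringCon.mk' f := rfl

theorem boundQuiver_mk_surjective : Function.Surjective I.ringCon.mk' := I.ringCon.mk'_surjective

theorem pathClass_eq_zero_iff {a b : Γ} {p : Path a b} :
    pathClass I p = 0 ↔ ofPath K p ∈ I := boundQuiver_mk_eq_zero_iff

theorem pathClass_mul {a b c : Γ} (q : Path b c) (p : Path a b) :
    pathClass I q * pathClass I p = pathClass I (p.comp q) := by
  rw [pathClass, pathClass, ← map_mul, ofPath_mul_ofPath]; rfl

theorem pathClass_mul_of_ne {a b c d : Γ} (q : Path c d) (p : Path a b) (h : b ≠ c) :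
    pathClass I q * pathClass I p = 0 := by
  rw [pathClass, pathClass, ← map_mul, ofPath_mul_ofPath_of_ne _ _ h, map_zero]

theorem arrowClass_mul_pathClass {a b c : Γ} (α : b ⟶ c) (p : Path a b) :
    arrowClass I α * pathClass I p = pathClass I (p.cons α) := pathClass_mul _ _

theorem pathClass_mul_arrowClass {a b c : Γ} (q : Path b c) (α : a ⟶ b) :
    pathClass I q * arrowClass I α = pathClass I (α.toPath.comp q) := pathClass_mul _ _

theorem sum_pathClass_nil : ∑ a : Γ, pathClass I (Path.nil : Path a a) = 1 := by
  rw [← map_one I.ringCon.mk', one_def, map_sum]; rfl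

/-- A bound quiver algebra is spanned by the classes of the paths. -/
theorem boundQuiver_induction {P : BoundQuiverAlgebra I → Prop} (c : BoundQuiverAlgebra I)
    (zero : P 0) (add : ∀ c d, P c → P d → P (c + d))
    (smul_path : ∀ (a b : Γ) (p : Path a b) (k : K), P (k • pathClass I p)) : P c := by
  obtain ⟨f, rfl⟩ := boundQuiver_mk_surjective c
  induction f using induction_ofPath with
  | zero => simpa using zero
  | add f g hf hg => simpa using add _ _ hf hg
  | smul_path a b p k => exact smul_path a b p k

/-- Every path occurring in an element of a monomial ideal belongs to the ideal. -/
theorem IsMonomialIdeal.ofPath_mem (hI : IsMonomialIdeal I) {f : PathAlgebra K Γ} (hf : f ∈ I)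
    {a b : Γ} {q : Path a b} (hq : f a b q ≠ 0) : ofPath K q ∈ I := by
  -- The elements all of whose paths lie in I form a two-sided ideal, since the paths in a product
  -- are concatenations of paths of the factors. It contains the generating paths of I, hence I.
  let N : TwoSidedIdeal (PathAlgebra K Γ) := TwoSidedIdeal.mk'
    {f | ∀ (a b : Γ) (q : Path a b), f a b q ≠ 0 → ofPath K q ∈ I}
    (fun a b q h => absurd rfl h)
    (fun {f g} hf hg a b q h => by
      by_cases h' : f a b q = 0
      · refine hg a b q fun h'' => h ?_
        rw [PathAlgebra.add_apply, Finsupp.add_apply, h', h'', add_zero]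
      · exact hf a b q h')
    (fun {f} hf a b q h => hf a b q fun h' => h (by
      change -(f a b q) = 0
      rw [h', neg_zero]))
    (fun {f g} hg a b q h => by
      obtain ⟨c, r, s, -, hs, rfl⟩ := exists_of_mul_apply_ne_zero h
      rw [← ofPath_mul_ofPath]
      exact I.mul_mem_left _ _ (hg _ _ _ hs))
    (fun {f g} hf a b q h => by
      obtain ⟨c, r, s, hr, -, rfl⟩ := exists_of_mul_apply_ne_zero h
      rw [← ofPath_mul_ofPath]
      exact I.mul_mem_right _ _ (hf _ _ _ hr))
  have hN : I ≤ N := by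
    obtain ⟨S, hS⟩ := hI
    conv_lhs => rw [hS]
    rw [TwoSidedIdeal.span_le]
    rintro _ ⟨⟨c, d, s⟩, hs, rfl⟩
    rw [SetLike.mem_coe, TwoSidedIdeal.mem_mk']
    intro a b q h
    cases ofPath_apply_ne_zero h
    rw [hS]
    exact TwoSidedIdeal.subset_span ⟨_, hs, rfl⟩
  have := hN hf
  rw [TwoSidedIdeal.mem_mk'] at this
  exact this a b q hq

/-- In an algebra bound by a monomial ideal, a nonzero path has zero coefficient in every
representative of zero. -/
theorem IsMonomialIdeal.apply_eq_zero (hI : IsMonomialIdeal I) {f : PathAlgebra K Γ}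
    (hf : I.ringCon.mk' f = 0) {a b : Γ} {q : Path a b} (hq : pathClass I q ≠ 0) :
    f a b q = 0 := by
  by_contra h
  exact hq (pathClass_eq_zero_iff.2 (hI.ofPath_mem (boundQuiver_mk_eq_zero_iff.1 hf) h))

theorem IsAdmissibleIdeal.exists_pathClass_eq_zero (hI : IsAdmissibleIdeal I) :
    ∃ m : ℕ, ∀ (a b : Γ) (q : Path a b), m ≤ q.length → pathClass I q = 0 := by
  obtain ⟨⟨m, hm⟩, -⟩ := hI
  exact ⟨m, fun a b q hq => pathClass_eq_zero_iff.2
    (hm (TwoSidedIdeal.subset_span ⟨a, b, q, hq, rfl⟩))⟩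

end BoundQuiver

/-! ### Factorizations of paths without oriented cycles -/

section Paths

variable {Γ : Type v} [Quiver.{w} Γ] {a b : Γ}

/-- Common last arrows are peeled off both factorizations; the length condition prevents r from
running out before r'. -/
theorem Quiver.Path.exists_comp_of_comp_eq_comp {x y : Γ} {u : Path a x} {r : Path x b}
    {u' : Path a y} {r' : Path y b} (h : u.comp r = u'.comp r') (hl : u.length ≤ u'.length) :
    ∃ s : Path x y, u' = u.comp s ∧ r = s.comp r' := by
  induction r' with
  | nil => exact ⟨r, h.symm, rfl⟩
  | cons r' e ih =>
    cases r with
    | nil =>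
      have := congrArg Path.length h
      simp only [Path.length_comp, Path.length_cons, Path.length_nil] at this
      omega
    | cons r e' =>
      rw [Path.comp_cons, Path.comp_cons] at h
      obtain rfl := Path.obj_eq_of_cons_eq_cons h
      obtain rfl := eq_of_heq (Path.hom_heq_of_cons_eq_cons h)
      obtain ⟨s, hs, rfl⟩ := ih (eq_of_heq (Path.heq_of_cons_eq_cons h))
      exact ⟨s, hs, rfl⟩

namespace IsTriangularQuiver

variable (hΓ : IsTriangularQuiver Γ)
include hΓ

theorem isEmpty_path_of_hom {x y : Γ} (e : x ⟶ y) (r : Path y x) : False := by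
  have := congrArg Path.length (hΓ y (r.cons e))
  simp at this

/-- A path without oriented cycles is split by each of its vertices in only one way. -/
theorem split_unique {x : Γ} {u u' : Path a x} {r r' : Path x b} (h : u.comp r = u'.comp r') :
    u = u' ∧ r = r' := by
  wlog hl : u.length ≤ u'.length generalizing u u' r r'
  · exact (this h.symm (le_of_not_ge hl)).imp Eq.symm Eq.symm
  obtain ⟨s, rfl, rfl⟩ := Path.exists_comp_of_comp_eq_comp h hl
  obtain rfl := hΓ x s
  simp

theorem vertices_nodup (p : Path a b) : p.vertices.Nodup := by
  induction p with
  | nil => simp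
  | cons p e ih =>
    rw [Path.vertices_cons, List.nodup_concat]
    refine ⟨fun h => ?_, ih⟩
    obtain ⟨_, r, -⟩ := p.exists_eq_comp_of_mem_vertices h
    exact hΓ.isEmpty_path_of_hom e r

end IsTriangularQuiver

theorem Quiver.Path.mem_vertices_of_eq_comp {p : Path a b} {x : Γ} {u : Path a x} {r : Path x b}
    (h : p = u.comp r) : x ∈ p.vertices := by
  rw [h, Path.vertices_comp, List.mem_append]
  exact Or.inr r.start_mem_vertices

end Paths

/-! ### Simple modules, the radical, and length as dimension -/

section Modules

variable {K : Type u} {Γ : Type v} [Field K] [Quiver.{w} Γ] [DecidableEq Γ] [Fintype Γ]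
  {I : TwoSidedIdeal (PathAlgebra K Γ)}

section

variable {M : Type x} [AddCommGroup M] [Module (BoundQuiverAlgebra I) M]

theorem sum_pathClass_nil_smul (m : M) :
    ∑ a : Γ, pathClass I (Path.nil : Path a a) • m = m := by
  rw [← Finset.sum_smul, sum_pathClass_nil, one_smul]

theorem pathClass_smul_smul {a b c : Γ} (q : Path b c) (p : Path a b) (m : M) :
    pathClass I q • pathClass I p • m = pathClass I (p.comp q) • m := by
  rw [smul_smul, pathClass_mul]

theorem pathClass_smul_smul_of_ne {a b c d : Γ} (q : Path c d) (p : Path a b) (h : b ≠ c) (m : M) :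
    pathClass I q • pathClass I p • m = 0 := by
  rw [smul_smul, pathClass_mul_of_ne _ _ h, zero_smul]

theorem arrowClass_smul_pathClass_smul {a b c : Γ} (α : b ⟶ c) (p : Path a b) (m : M) :
    arrowClass I α • pathClass I p • m = pathClass I (p.cons α) • m :=
  pathClass_smul_smul _ _ _

/-- A nonzero module has a nonzero element concentrated at one vertex that is annihilated by all
paths of positive length. -/
theorem IsAdmissibleIdeal.exists_socle_element (hI : IsAdmissibleIdeal I) [Nontrivial M] :
    ∃ (b : Γ) (y : M), y ≠ 0 ∧ pathClass I (Path.nil : Path b b) • y = y ∧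
      ∀ (c d : Γ) (r : Path c d), 0 < r.length → pathClass I r • y = 0 := by
  obtain ⟨m, hm⟩ := hI.exists_pathClass_eq_zero
  obtain ⟨x, hx⟩ := exists_ne (0 : M)
  -- Lengths of the paths not annihilating x are bounded by admissibility; a longest such path q
  -- yields the element q x.
  let S : Set ℕ := {l | ∃ (a b : Γ) (q : Path a b), q.length = l ∧ pathClass I q • x ≠ 0}
  have hS : S.Nonempty := by
    by_contra h
    refine hx ?_
    rw [← sum_pathClass_nil_smul (I := I) x]
    refine Finset.sum_eq_zero fun a _ => ?_
    by_contra h'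
    exact h ⟨0, a, a, Path.nil, rfl, h'⟩
  have hb : BddAbove S := by
    refine ⟨m, ?_⟩
    rintro _ ⟨a, b, q, rfl, hq⟩
    by_contra h
    exact hq (by rw [hm a b q (le_of_not_ge h), zero_smul])
  obtain ⟨a, b, q, hl, hq⟩ := Nat.sSup_mem hS hb
  refine ⟨b, pathClass I q • x, hq, by rw [pathClass_smul_smul, Path.comp_nil], ?_⟩
  intro c d r hr
  by_cases hc : b = c
  · subst hc
    rw [pathClass_smul_smul]
    by_contra h
    have := le_csSup hb ⟨a, d, q.comp r, rfl, h⟩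
    rw [Path.length_comp] at this
    omega
  · exact pathClass_smul_smul_of_ne _ _ hc _

end

variable {M : Type x} [AddCommGroup M] [Module (BoundQuiverAlgebra I) M] [Module K M]
  [IsScalarTower K (BoundQuiverAlgebra I) M]

/-- Every element of a simple module is a scalar multiple of an element annihilated by all paths of
positive length. -/
theorem IsAdmissibleIdeal.exists_generator_of_isSimpleModule (hI : IsAdmissibleIdeal I)
    [IsSimpleModule (BoundQuiverAlgebra I) M] :
    ∃ y : M, y ≠ 0 ∧ (∀ (c d : Γ) (r : Path c d), 0 < r.length → pathClass I r • y = 0) ∧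
      ∀ m : M, ∃ k : K, k • y = m := by
  have := IsSimpleModule.nontrivial (BoundQuiverAlgebra I) M
  obtain ⟨b, y, hy, hb, hr⟩ := hI.exists_socle_element (M := M)
  refine ⟨y, hy, hr, fun m => ?_⟩
  obtain ⟨c, rfl⟩ := IsSimpleModule.toSpanSingleton_surjective (BoundQuiverAlgebra I) hy m
  rw [LinearMap.toSpanSingleton_apply]
  induction c using boundQuiver_induction with
  | zero => exact ⟨0, by simp⟩
  | add c d hc hd =>
    obtain ⟨k, hk⟩ := hc
    obtain ⟨l, hl⟩ := hd
    exact ⟨k + l, by rw [add_smul, add_smul, hk, hl]⟩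
  | smul_path s t q k =>
    cases q with
    | nil =>
      by_cases hs : s = b
      · subst hs
        exact ⟨k, by rw [smul_assoc, hb]⟩
      · refine ⟨0, ?_⟩
        rw [smul_assoc, ← hb, pathClass_smul_smul_of_ne _ _ (Ne.symm hs), zero_smul, smul_zero]
    | cons q e =>
      exact ⟨0, by rw [smul_assoc, hr _ _ (q.cons e) (Nat.succ_pos _), zero_smul, smul_zero]⟩

theorem IsAdmissibleIdeal.pathClass_smul_eq_zero (hI : IsAdmissibleIdeal I)
    [IsSimpleModule (BoundQuiverAlgebra I) M] {a b : Γ} (q : Path a b) (hq : 0 < q.length)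
    (m : M) : pathClass I q • m = 0 := by
  obtain ⟨y, -, hr, hm⟩ := hI.exists_generator_of_isSimpleModule (K := K) (M := M)
  obtain ⟨k, rfl⟩ := hm m
  rw [smul_comm, hr _ _ _ hq, smul_zero]

/-- The path annihilates the simple module Λ/m for every maximal left ideal m; applied to the class
of 1, this puts it in m. -/
theorem IsAdmissibleIdeal.pathClass_mem_jacobson (hI : IsAdmissibleIdeal I) {a b : Γ}
    (q : Path a b) (hq : 0 < q.length) : pathClass I q ∈ Ring.jacobson (BoundQuiverAlgebra I) := by
  rw [Ring.jacobson_eq_sInf_isMaximal, Submodule.mem_sInf]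
  intro m hm
  have : IsSimpleModule (BoundQuiverAlgebra I) (BoundQuiverAlgebra I ⧸ m) :=
    isSimpleModule_iff_isCoatom.2 (Ideal.isMaximal_def.1 hm)
  have h := hI.pathClass_smul_eq_zero (K := K) q hq (Submodule.Quotient.mk (p := m) 1)
  rwa [← Submodule.Quotient.mk_smul, smul_eq_mul, mul_one, Submodule.Quotient.mk_eq_zero] at h

theorem IsAdmissibleIdeal.length_eq_one_of_isSimpleModule (hI : IsAdmissibleIdeal I)
    [IsSimpleModule (BoundQuiverAlgebra I) M] : Module.length K M = 1 := by
  obtain ⟨y, hy, -, hm⟩ := hI.exists_generator_of_isSimpleModule (K := K) (M := M)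
  rw [Module.length_eq_one_iff, isSimpleModule_iff_finrank_eq_one]
  exact finrank_eq_one y hy hm

theorem Module.length_eq_add_quotient_restrictScalars (N : Submodule (BoundQuiverAlgebra I) M) :
    Module.length K M = Module.length K N + Module.length K (M ⧸ N) :=
  Module.length_eq_add_of_exact (N.subtype.restrictScalars K) (N.mkQ.restrictScalars K)
    N.injective_subtype N.mkQ_surjective (LinearMap.exact_subtype_mkQ N)

/-- The length of a module over a bound quiver algebra is its dimension. -/
theorem IsAdmissibleIdeal.length_eq (hI : IsAdmissibleIdeal I) {M : Type x} [AddCommGroup M]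
    [Module (BoundQuiverAlgebra I) M] (hM : IsFiniteLength (BoundQuiverAlgebra I) M) :
    ∀ [Module K M] [IsScalarTower K (BoundQuiverAlgebra I) M],
      Module.length K M = Module.length (BoundQuiverAlgebra I) M := by
  -- The K-structure is quantified after `hM`, so the induction hypothesis applies to the submodule
  -- with its restricted structure.
  induction hM with
  | of_subsingleton => intros; simp
  | of_simple_quotient _ ih =>
    rename_i M _ _ N _ _
    intros
    rw [Module.length_eq_add_quotient_restrictScalars (I := I) N, ih,
      hI.length_eq_one_of_isSimpleModule, Module.length_eq_add_of_exact N.subtype N.mkQ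
        N.injective_subtype N.mkQ_surjective (LinearMap.exact_subtype_mkQ N),
      Module.length_eq_one (BoundQuiverAlgebra I) (M ⧸ N)]

/-- A `K`-linear map commuting with the trivial paths and the arrows is a homomorphism. -/
theorem map_smul_of_map_arrowClass_smul {N : Type*} [AddCommGroup N]
    [Module (BoundQuiverAlgebra I) N] [Module K N] [IsScalarTower K (BoundQuiverAlgebra I) N]
    (f : M →ₗ[K] N)
    (hnil : ∀ (a : Γ) (m : M), f (pathClass I (Path.nil : Path a a) • m)
      = pathClass I (Path.nil : Path a a) • f m)
    (harrow : ∀ (a b : Γ) (α : a ⟶ b) (m : M), f (arrowClass I α • m) = arrowClass I α • f m)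
    (c : BoundQuiverAlgebra I) (m : M) : f (c • m) = c • f m := by
  induction c using boundQuiver_induction with
  | zero => simp
  | add c d hc hd => rw [add_smul, map_add, hc, hd, add_smul]
  | smul_path a b q k =>
    rw [smul_assoc, map_smul, smul_assoc]
    congr 1
    induction q with
    | nil => exact hnil a m
    | cons q α ih =>
      rw [← arrowClass_smul_pathClass_smul, harrow, ih, arrowClass_smul_pathClass_smul]

end Modules

/-! ### Left and right subpaths of p as elements of the algebra -/

section Subpaths

variable {K : Type u} {Γ : Type v} [Field K] [Quiver.{w} Γ] [DecidableEq Γ] [Fintype Γ]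
  (I : TwoSidedIdeal (PathAlgebra K Γ)) {a b : Γ} (p : Path a b)

open Classical in
/-- The class of the right subpath of `p` ending in `v`, and zero if `v` is not on `p`. -/
noncomputable def prefixClass (v : Γ) : BoundQuiverAlgebra I :=
  if h : ∃ u : Path a v, IsRightSubpath u p then pathClass I h.choose else 0

open Classical in
/-- The class of the left subpath of `p` starting in `v`, and zero if `v` is not on `p`. -/
noncomputable def suffixClass (v : Γ) : BoundQuiverAlgebra I :=
  if h : ∃ r : Path v b, IsLeftSubpath r p then pathClass I h.choose else 0

variable {p}

theorem prefixClass_eq (hΓ : IsTriangularQuiver Γ) {v : Γ} {u : Path a v} {r : Path v b}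
    (h : p = u.comp r) : prefixClass I p v = pathClass I u := by
  have h' : ∃ u : Path a v, IsRightSubpath u p := ⟨u, r, h⟩
  rw [prefixClass, dif_pos h']
  obtain ⟨r', hr'⟩ := h'.choose_spec
  rw [(hΓ.split_unique (hr'.symm.trans h)).1]

theorem suffixClass_eq (hΓ : IsTriangularQuiver Γ) {v : Γ} {u : Path a v} {r : Path v b}
    (h : p = u.comp r) : suffixClass I p v = pathClass I r := by
  have h' : ∃ r : Path v b, IsLeftSubpath r p := ⟨r, u, h⟩
  rw [suffixClass, dif_pos h']
  obtain ⟨u', hu'⟩ := h'.choose_spec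
  rw [(hΓ.split_unique (hu'.symm.trans h)).2]

theorem prefixClass_of_notMem {v : Γ} (h : v ∉ p.vertices) : prefixClass I p v = 0 :=
  dif_neg fun ⟨_, _, h'⟩ => h (Path.mem_vertices_of_eq_comp h')

theorem pathClass_mul_prefixClass_of_ne {v c d : Γ} (q : Path c d) (h : v ≠ c) :
    pathClass I q * prefixClass I p v = 0 := by
  rw [prefixClass]
  split_ifs
  · exact pathClass_mul_of_ne _ _ h
  · exact mul_zero _

theorem nil_mul_prefixClass (v : Γ) :
    pathClass I (Path.nil : Path v v) * prefixClass I p v = prefixClass I p v := by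
  rw [prefixClass]
  split_ifs
  · rw [pathClass_mul, Path.comp_nil]
  · exact mul_zero _

theorem suffixClass_mul_pathClass_of_ne {v c d : Γ} (q : Path c d) (h : d ≠ v) :
    suffixClass I p v * pathClass I q = 0 := by
  rw [suffixClass]
  split_ifs
  · exact pathClass_mul_of_ne _ _ h
  · exact zero_mul _

theorem suffixClass_mul_nil (v : Γ) :
    suffixClass I p v * pathClass I (Path.nil : Path v v) = suffixClass I p v := by
  rw [suffixClass]
  split_ifs
  · rw [pathClass_mul, Path.nil_comp]
  · exact zero_mul _

theorem suffixClass_mul_prefixClass (hΓ : IsTriangularQuiver Γ) {v : Γ} (h : v ∈ p.vertices) :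
    suffixClass I p v * prefixClass I p v = pathClass I p := by
  obtain ⟨u, r, h⟩ := p.exists_eq_comp_of_mem_vertices h
  rw [suffixClass_eq I hΓ h, prefixClass_eq I hΓ h, pathClass_mul, ← h]

theorem prefixClass_source (hΓ : IsTriangularQuiver Γ) :
    prefixClass I p a = pathClass I (Path.nil : Path a a) :=
  prefixClass_eq I hΓ p.nil_comp.symm

theorem prefixClass_target (hΓ : IsTriangularQuiver Γ) : prefixClass I p b = pathClass I p :=
  prefixClass_eq I hΓ p.comp_nil.symm

theorem suffixClass_source (hΓ : IsTriangularQuiver Γ) : suffixClass I p a = pathClass I p :=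
  suffixClass_eq I hΓ p.nil_comp.symm

/-- Arrows of p carry each mast basis vector to the next one. -/
theorem IsArrowOf.arrowClass_mul_prefixClass (hΓ : IsTriangularQuiver Γ) {x y : Γ} {α : x ⟶ y}
    (h : IsArrowOf α p) : arrowClass I α * prefixClass I p x = prefixClass I p y := by
  obtain ⟨u, r, h⟩ := h
  rw [prefixClass_eq I hΓ h, prefixClass_eq I hΓ (u := u) (r := α.toPath.comp r),
    arrowClass_mul_pathClass]
  rw [h, ← Path.comp_assoc, Path.comp_toPath_eq_cons]

theorem IsArrowOf.suffixClass_mul_arrowClass (hΓ : IsTriangularQuiver Γ) {x y : Γ} {α : x ⟶ y}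
    (h : IsArrowOf α p) : suffixClass I p y * arrowClass I α = suffixClass I p x := by
  obtain ⟨u, r, h⟩ := h
  rw [suffixClass_eq I hΓ h, suffixClass_eq I hΓ (u := u) (r := α.toPath.comp r),
    pathClass_mul_arrowClass]
  rw [h, ← Path.comp_assoc, Path.comp_toPath_eq_cons]

omit [DecidableEq Γ] [Fintype Γ] in
theorem IsArrowOf.target_mem {x y : Γ} {α : x ⟶ y} (h : IsArrowOf α p) : y ∈ p.vertices := by
  obtain ⟨u, r, h⟩ := h
  exact Path.mem_vertices_of_eq_comp h

omit [DecidableEq Γ] [Fintype Γ] in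
theorem IsArrowOf.target_ne (hΓ : IsTriangularQuiver Γ) {x y : Γ} {α : x ⟶ y}
    (h : IsArrowOf α p) : y ≠ a := by
  rintro rfl
  obtain ⟨u, -, -⟩ := h
  exact hΓ.isEmpty_path_of_hom α u

end Subpaths

/-! ### The basis of a module with mast p -/

section Mast

variable {K : Type u} {Γ : Type v} [Field K] [Quiver.{w} Γ] [DecidableEq Γ] [Fintype Γ]
  {I : TwoSidedIdeal (PathAlgebra K Γ)} {a b : Γ} {p : Path a b}
  {U : Type x} [AddCommGroup U] [Module (BoundQuiverAlgebra I) U]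

/-- The complementary left subpath carries this vector to p x₀. -/
theorem prefixClass_smul_ne_zero (hΓ : IsTriangularQuiver Γ) {x₀ : U}
    (h₀ : pathClass I p • x₀ ≠ 0) {v : Γ} (hv : v ∈ p.vertices) :
    prefixClass I p v • x₀ ≠ 0 := by
  intro h
  rw [← suffixClass_mul_prefixClass I hΓ hv, mul_smul, h, smul_zero] at h₀
  exact h₀ rfl

variable [Module K U] [IsScalarTower K (BoundQuiverAlgebra I) U]

theorem IsMast.finrank_eq (hI : IsAdmissibleIdeal I) (hp : IsMast I U p) :
    Module.finrank K U = p.length + 1 := by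
  have hfin : IsFiniteLength (BoundQuiverAlgebra I) U := by
    rw [← Module.length_ne_top_iff, hp.1]
    exact ENat.natCast_ne_top (p.length + 1)
  have h := hI.length_eq hfin
  rw [hp.1, Module.length_eq_rank] at h
  rw [Module.finrank, ← Cardinal.toNat_toENat, h]
  rfl

/-- The trivial path at v isolates the single term at v in a linear relation. -/
theorem linearIndependent_prefixClass_smul (hΓ : IsTriangularQuiver Γ) {x₀ : U}
    (h₀ : pathClass I p • x₀ ≠ 0) :
    LinearIndependent K fun v : {v // v ∈ p.vertices} => prefixClass I p v • x₀ := by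
  rw [Fintype.linearIndependent_iff]
  intro g hg v
  have h := congrArg (pathClass I (Path.nil : Path (v : Γ) v) • ·) hg
  simp only [Finset.smul_sum, smul_zero] at h
  rw [Finset.sum_eq_single v] at h
  · rw [smul_comm, ← mul_smul, nil_mul_prefixClass] at h
    exact (smul_eq_zero.1 h).resolve_right (prefixClass_smul_ne_zero hΓ h₀ v.2)
  · intro w _ hw
    rw [smul_comm, ← mul_smul, pathClass_mul_prefixClass_of_ne _ _ (fun h => hw (Subtype.ext h)),
      zero_smul, smul_zero]
  · simp

/-- A module with mast `p` has a basis indexed by the vertices of `p`. -/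
noncomputable def mastBasis (hΓ : IsTriangularQuiver Γ) (hI : IsAdmissibleIdeal I)
    (hp : IsMast I U p) {x₀ : U} (h₀ : pathClass I p • x₀ ≠ 0) :
    Module.Basis {v // v ∈ p.vertices} K U :=
  haveI : Nonempty {v // v ∈ p.vertices} := ⟨⟨a, p.start_mem_vertices⟩⟩
  basisOfLinearIndependentOfCardEqFinrank (linearIndependent_prefixClass_smul hΓ h₀) (by
    rw [hp.finrank_eq hI, ← Path.vertices_length, ← List.toFinset_card_of_nodup
      (hΓ.vertices_nodup p), Fintype.card_of_subtype]
    simp)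

theorem mastBasis_apply (hΓ : IsTriangularQuiver Γ) (hI : IsAdmissibleIdeal I)
    (hp : IsMast I U p) {x₀ : U} (h₀ : pathClass I p • x₀ ≠ 0) (v : {v // v ∈ p.vertices}) :
    mastBasis hΓ hI hp h₀ v = prefixClass I p v • x₀ := by
  simp [mastBasis]

variable (hΓ : IsTriangularQuiver Γ) (hI : IsAdmissibleIdeal I) (hp : IsMast I U p) {x₀ : U}
  (h₀ : pathClass I p • x₀ ≠ 0)
include hΓ hI hp h₀

theorem mast_induction {P : U → Prop} (y : U) (zero : P 0) (add : ∀ y z, P y → P z → P (y + z))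
    (smul : ∀ (k : K) y, P y → P (k • y))
    (basis : ∀ v ∈ p.vertices, P (prefixClass I p v • x₀)) : P y := by
  rw [← (mastBasis hΓ hI hp h₀).sum_repr y]
  refine Finset.sum_induction _ P add zero fun v _ => smul _ _ ?_
  rw [mastBasis_apply]
  exact basis v v.2

/-- The part of a module with mast `p` at the vertex `v` is spanned by one element. -/
theorem exists_nil_smul_eq (v : Γ) (y : U) :
    ∃ k : K, pathClass I (Path.nil : Path v v) • y = k • prefixClass I p v • x₀ := by
  induction y using mast_induction (K := K) hΓ hI hp h₀ with
  | zero => exact ⟨0, by simp⟩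
  | add y z hy hz =>
    obtain ⟨k, hk⟩ := hy
    obtain ⟨l, hl⟩ := hz
    exact ⟨k + l, by rw [smul_add, hk, hl, add_smul]⟩
  | smul k y hy =>
    obtain ⟨l, hl⟩ := hy
    exact ⟨k * l, by rw [smul_comm, hl, mul_smul]⟩
  | basis w _ =>
    rw [← mul_smul]
    by_cases h : w = v
    · subst h
      exact ⟨1, by rw [nil_mul_prefixClass, one_smul]⟩
    · exact ⟨0, by rw [pathClass_mul_prefixClass_of_ne _ _ h, zero_smul, zero_smul]⟩

theorem exists_arrowClass_smul_eq {v w : Γ} (α : v ⟶ w) (y : U) :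
    ∃ k : K, arrowClass I α • y = k • prefixClass I p w • x₀ := by
  obtain ⟨k, hk⟩ := exists_nil_smul_eq hΓ hI hp h₀ w (arrowClass I α • y)
  refine ⟨k, ?_⟩
  rw [← hk, arrowClass, pathClass_smul_smul, Path.comp_nil]

/-- The result could only be a multiple of the basis vector at w; but if w were on p, β and the rest
of p would close an oriented cycle. -/
theorem arrowClass_smul_pathClass_smul_eq_zero {w : Γ} (β : b ⟶ w) :
    arrowClass I β • pathClass I p • x₀ = 0 := by
  obtain ⟨k, hk⟩ := exists_arrowClass_smul_eq hΓ hI hp h₀ β (pathClass I p • x₀)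
  rw [hk, prefixClass_of_notMem, zero_smul, smul_zero]
  intro h
  obtain ⟨_, r, -⟩ := p.exists_eq_comp_of_mem_vertices h
  exact hΓ.isEmpty_path_of_hom β r

/-- If arrows off the mast annihilate the right subpaths of the mast, they annihilate the
module. -/
theorem arrowClass_smul_eq_zero_of_not_isArrowOf
    (hA : ∀ (x y : Γ) (ε : x ⟶ y), x ∈ p.vertices → x ≠ b → ¬ IsArrowOf ε p →
      arrowClass I ε * prefixClass I p x = 0)
    {v w : Γ} (ε : v ⟶ w) (hε : ¬ IsArrowOf ε p) (y : U) : arrowClass I ε • y = 0 := by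
  induction y using mast_induction (K := K) hΓ hI hp h₀ with
  | zero => simp
  | add y z hy hz => rw [smul_add, hy, hz, add_zero]
  | smul k y hy => rw [smul_comm, hy, smul_zero]
  | basis x hx =>
    by_cases h : x = v
    · subst h
      by_cases hb : x = b
      · subst hb
        rw [prefixClass_target I hΓ]
        exact arrowClass_smul_pathClass_smul_eq_zero hΓ hI hp h₀ ε
      · rw [← mul_smul, hA _ _ ε hx hb hε, zero_smul]
    · rw [← mul_smul, arrowClass, pathClass_mul_prefixClass_of_ne _ _ h, zero_smul]

theorem span_generator_eq_top : Submodule.span (BoundQuiverAlgebra I) {x₀} = ⊤ := by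
  rw [eq_top_iff]
  rintro y -
  induction y using mast_induction (K := K) hΓ hI hp h₀ with
  | zero => exact zero_mem _
  | add y z hy hz => exact add_mem hy hz
  | smul k y hy =>
    rw [← algebraMap_smul (BoundQuiverAlgebra I)]
    exact Submodule.smul_mem _ _ hy
  | basis x _ =>
    exact Submodule.smul_mem _ _ (Submodule.mem_span_singleton_self _)

omit hp h₀ [Module K U] [IsScalarTower K (BoundQuiverAlgebra I) U] in
theorem prefixClass_smul_mem_radSubmodule {v : Γ} (hv : v ≠ a) (y : U) :
    prefixClass I p v • y ∈ radSubmodule (BoundQuiverAlgebra I) U := by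
  by_cases h : v ∈ p.vertices
  · obtain ⟨u, r, h⟩ := p.exists_eq_comp_of_mem_vertices h
    rw [prefixClass_eq I hΓ h]
    refine Submodule.smul_mem_smul (hI.pathClass_mem_jacobson u ?_) Submodule.mem_top
    by_contra h'
    exact hv (u.eq_of_length_zero (by omega)).symm
  · rw [prefixClass_of_notMem I h, zero_smul]
    exact zero_mem _

/-- The radical of a module with mast `p` vanishes at the first vertex of `p`. -/
theorem nil_smul_eq_zero_of_mem_radSubmodule [Module.Finite (BoundQuiverAlgebra I) U]
    (hx₀ : pathClass I (Path.nil : Path a a) • x₀ = x₀) {y : U}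
    (hy : y ∈ radSubmodule (BoundQuiverAlgebra I) U) :
    pathClass I (Path.nil : Path a a) • y = 0 := by
  have hU : Nontrivial U := ⟨⟨_, _, h₀⟩⟩
  -- By Nakayama JU is proper. A nonzero component at a would be a nonzero multiple of x₀, and x₀
  -- generates U.
  have hlt : radSubmodule (BoundQuiverAlgebra I) U < ⊤ := Submodule.jacobson_smul_lt_top ⊤
  obtain ⟨k, hk⟩ := exists_nil_smul_eq hΓ hI hp h₀ a y
  rw [prefixClass_source I hΓ, hx₀] at hk
  rw [hk]
  by_contra hne
  have hk0 : k ≠ 0 := by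
    rintro rfl
    simp at hne
  refine hlt.ne (eq_top_iff.2 ?_)
  rw [← span_generator_eq_top hΓ hI hp h₀, Submodule.span_singleton_le_iff_mem]
  have h : x₀ = (algebraMap K (BoundQuiverAlgebra I) k⁻¹) •
      pathClass I (Path.nil : Path a a) • y := by
    rw [hk, algebraMap_smul, inv_smul_smul₀ hk0]
  rw [h]
  exact Submodule.smul_mem _ _ (Submodule.smul_mem _ _ hy)

/-- The basis vectors at the vertices other than a generate JU. This keeps the test module of the
necessity proof finitely generated. -/
theorem radSubmodule_fg [Module.Finite (BoundQuiverAlgebra I) U]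
    (hx₀ : pathClass I (Path.nil : Path a a) • x₀ = x₀) :
    (radSubmodule (BoundQuiverAlgebra I) U).FG := by
  have h : radSubmodule (BoundQuiverAlgebra I) U = Submodule.span (BoundQuiverAlgebra I)
      ((fun v => prefixClass I p v • x₀) '' {v | v ≠ a}) := by
    refine le_antisymm (fun y hy => ?_) (Submodule.span_le.2 ?_)
    · rw [← sum_pathClass_nil_smul (I := I) y]
      refine Submodule.sum_mem _ fun v _ => ?_
      by_cases hv : v = a
      · subst hv
        rw [nil_smul_eq_zero_of_mem_radSubmodule hΓ hI hp h₀ hx₀ hy]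
        exact zero_mem _
      · obtain ⟨k, hk⟩ := exists_nil_smul_eq hΓ hI hp h₀ v y
        rw [hk, ← algebraMap_smul (BoundQuiverAlgebra I)]
        exact Submodule.smul_mem _ _ (Submodule.subset_span ⟨v, hv, rfl⟩)
    · rintro _ ⟨v, hv, rfl⟩
      exact prefixClass_smul_mem_radSubmodule hΓ hI hv x₀
  rw [h]
  exact Submodule.fg_span (Set.toFinite _)

end Mast

/-! ### Necessity of the conditions -/

section Necessity

open PathAlgebra

variable {K : Type u} {Γ : Type v} [Field K] [Quiver.{w} Γ] [DecidableEq Γ] [Fintype Γ]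
  {I : TwoSidedIdeal (PathAlgebra K Γ)} {a b : Γ} {p : Path a b}

theorem prefixClass_mul_nil (v : Γ) :
    prefixClass I p v * pathClass I (Path.nil : Path a a) = prefixClass I p v := by
  rw [prefixClass]
  split_ifs
  · rw [pathClass_mul, Path.nil_comp]
  · exact zero_mul _

/-- In a quiver without oriented cycles, the endomorphism ring of an indecomposable projective
module is `K`. -/
theorem IsTriangularQuiver.exists_nil_mul_mul_nil (hΓ : IsTriangularQuiver Γ) (v : Γ)
    (c : BoundQuiverAlgebra I) :
    ∃ k : K, pathClass I (Path.nil : Path v v) * c * pathClass I (Path.nil : Path v v)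
      = k • pathClass I (Path.nil : Path v v) := by
  induction c using boundQuiver_induction with
  | zero => exact ⟨0, by simp⟩
  | add c d hc hd =>
    obtain ⟨k, hk⟩ := hc
    obtain ⟨l, hl⟩ := hd
    exact ⟨k + l, by rw [mul_add, add_mul, hk, hl, add_smul]⟩
  | smul_path x y q k =>
    rw [mul_smul_comm, smul_mul_assoc]
    by_cases hx : v = x
    · by_cases hy : y = v
      · subst hx hy
        refine ⟨k, ?_⟩
        rw [hΓ _ q, pathClass_mul, pathClass_mul]
        rfl
      · exact ⟨0, by rw [pathClass_mul_of_ne _ _ hy, zero_mul, smul_zero, zero_smul]⟩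
    · exact ⟨0, by rw [mul_assoc, pathClass_mul_of_ne _ _ hx, mul_zero, smul_zero, zero_smul]⟩

variable {U : Type (max u v w)} [AddCommGroup U] [Module (BoundQuiverAlgebra I) U]
  [Module.Finite (BoundQuiverAlgebra I) U] [Module K U] [IsScalarTower K (BoundQuiverAlgebra I) U]
  (hΓ : IsTriangularQuiver Γ) (hI : IsAdmissibleIdeal I) (hp : IsMast I U p) {x₀ : U}
  (h₀ : pathClass I p • x₀ ≠ 0) (hx₀ : pathClass I (Path.nil : Path a a) • x₀ = x₀)
include hΓ hI hp h₀ hx₀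

/-- The consequence of factoring an irreducible embedding `JU → U` through the quotient of
`JU × Λ × Λ` by the submodule generated by `(p x₀, -p, -r)`. -/
theorem exists_factor_of_isIrreducibleHom (hab : a ≠ b)
    (hirr : IsIrreducibleHom (radSubmodule (BoundQuiverAlgebra I) U).subtype)
    (r : BoundQuiverAlgebra I) (hr : ∀ m ∈ radSubmodule (BoundQuiverAlgebra I) U, r • m = 0) :
    ∃ s : BoundQuiverAlgebra I, ∀ c : BoundQuiverAlgebra I,
      c * pathClass I (Path.nil : Path a a) = c → c • x₀ = 0 →
        ∃ d, c = d * pathClass I p ∧ c * s = d * r := by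
  let R := BoundQuiverAlgebra I
  let N : Submodule R U := radSubmodule R U
  have hmem : pathClass I p • x₀ ∈ N := by
    rw [← prefixClass_target I hΓ]
    exact prefixClass_smul_mem_radSubmodule hΓ hI hab.symm x₀
  have hpe : pathClass I p * pathClass I (Path.nil : Path a a) = pathClass I p := by
    rw [pathClass_mul, Path.nil_comp]
  have hpN : ∀ m : N, pathClass I p • m = 0 := fun m => by
    rw [← hpe, mul_smul]
    have : pathClass I (Path.nil : Path a a) • m = 0 := Subtype.ext
      (nil_smul_eq_zero_of_mem_radSubmodule hΓ hI hp h₀ hx₀ m.2)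
    rw [this, smul_zero]
  -- Modulo z, the element p x₀ of JU becomes p·(0,1,0) + r·(0,0,1).
  let z : N × R × R := (⟨_, hmem⟩, -pathClass I p, -r)
  let S : Submodule R (N × R × R) := Submodule.span R {z}
  -- Being zero on the last factor, `h'` kills z whatever r is.
  let h' : N × R × R →ₗ[R] U :=
    N.subtype.coprod ((LinearMap.toSpanSingleton R U x₀).coprod (0 : R →ₗ[R] U))
  have hh' : ∀ (n : N) (c d : R), h' (n, c, d) = n + c • x₀ := fun n c d => by
    simp [h']
  have hS : S ≤ LinearMap.ker h' := by
    rw [Submodule.span_singleton_le_iff_mem, LinearMap.mem_ker, hh']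
    simp
  let g : N →ₗ[R] (N × R × R) ⧸ S := S.mkQ ∘ₗ LinearMap.inl R N (R × R)
  let h : ((N × R × R) ⧸ S) →ₗ[R] U := S.liftQ h' hS
  have hhg : h ∘ₗ g = N.subtype := by
    ext n
    change h' (n, 0, 0) = n
    rw [hh', zero_smul, add_zero]
  have hfin : Module.Finite R N := Module.Finite.iff_fg.2 (radSubmodule_fg hΓ hI hp h₀ hx₀)
  rcases hirr.2.2 _ g h hhg with ⟨ρ, hρ⟩ | ⟨σ, hσ⟩
  -- A retraction would write p x₀ as p m + r m' with m, m' in JU, which is 0.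
  · exfalso
    have h1 : g ⟨_, hmem⟩ = pathClass I p • S.mkQ (0, 1, 0) + r • S.mkQ (0, 0, 1) := by
      rw [← sub_eq_zero, ← map_smul, ← map_smul, ← map_add]
      change S.mkQ (⟨_, hmem⟩, 0, 0) - _ = 0
      rw [← map_sub, Submodule.mkQ_apply, Submodule.Quotient.mk_eq_zero]
      convert Submodule.mem_span_singleton_self (R := R) z using 1
      simp [z]
    have h2 := congrArg ρ h1
    rw [map_add, map_smul, map_smul, hpN, zero_add] at h2
    have h3 : ρ (g ⟨_, hmem⟩) = ⟨_, hmem⟩ := LinearMap.congr_fun hρ _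
    rw [h3] at h2
    have h4 := congrArg Subtype.val h2
    rw [Submodule.coe_smul, hr _ (Subtype.property _)] at h4
    exact h₀ h4
  · obtain ⟨⟨n, c', s'⟩, hn⟩ := S.mkQ_surjective (σ x₀)
    set e := pathClass I (Path.nil : Path a a) with he
    -- Since x₀ = e x₀, a lift of σ x₀ may be multiplied by e, which removes its component in JU.
    have h1 : S.mkQ (0, e * c', e * s') = σ x₀ := by
      conv_rhs => rw [← hx₀, map_smul, ← hn, ← map_smul]
      congr 1
      have : e • n = 0 := Subtype.ext
        (nil_smul_eq_zero_of_mem_radSubmodule hΓ hI hp h₀ hx₀ n.2)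
      rw [Prod.smul_mk, Prod.smul_mk, this]
      rfl
    have h2 : (e * c') • x₀ = x₀ := by
      have h3 : h (σ x₀) = x₀ := LinearMap.congr_fun hσ _
      rw [← h1] at h3
      have h4 : h' (0, e * c', e * s') = x₀ := h3
      rwa [hh', Submodule.coe_zero, zero_add] at h4
    -- The corner at a consists of scalar multiples of e, and evaluation at x₀ shows that the scalar
    -- is 1.
    have h3 : e * c' * e = e := by
      obtain ⟨k, hk⟩ := hΓ.exists_nil_mul_mul_nil (I := I) a c'
      have hne : x₀ ≠ 0 := by
        rintro rfl
        simp at h₀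
      have h4 : k • x₀ = (1 : K) • x₀ := by
        rw [one_smul]
        conv_rhs => rw [← h2, ← hx₀, ← mul_smul, hk, smul_assoc, hx₀]
      rw [hk, smul_left_injective K hne h4, one_smul]
    refine ⟨e * s', fun c hce hc => ?_⟩
    -- The relation c x₀ = 0 annihilates σ x₀, so c times its lift is a multiple of z. The signs in
    -- z account for the `-d` below.
    have h4 : S.mkQ (c • ((0 : N), e * c', e * s')) = 0 := by
      rw [map_smul, h1, ← map_smul, hc, map_zero]
    rw [Submodule.mkQ_apply, Submodule.Quotient.mk_eq_zero, Submodule.mem_span_singleton] at h4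
    obtain ⟨d, hd⟩ := h4
    have h5 : d * -pathClass I p = c * (e * c') := congrArg (fun t => t.2.1) hd
    have h6 : d * -r = c * (e * s') := congrArg (fun t => t.2.2) hd
    refine ⟨-d, ?_, ?_⟩
    · calc c = c * (e * c' * e) := by rw [h3, hce]
        _ = c * (e * c') * e := (mul_assoc _ _ _).symm
        _ = -d * pathClass I p := by rw [← h5, mul_neg, neg_mul, mul_assoc, hpe, neg_mul]
    · rw [← h6, mul_neg, neg_mul]

/-- With r = 0, all relations of x₀ at a lie in Λp. Since ε u x₀ is a multiple of the basis vector
at y, subtracting that multiple gives such a relation, in which the path εu occurs with coefficient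
1 but cannot occur in Λp. -/
theorem arrowClass_mul_prefixClass_eq_zero_of_isIrreducibleHom (hmon : IsMonomialIdeal I)
    (hab : a ≠ b) (hirr : IsIrreducibleHom (radSubmodule (BoundQuiverAlgebra I) U).subtype)
    {x y : Γ} (ε : x ⟶ y) (hx : x ∈ p.vertices) (hxb : x ≠ b) (hε : ¬ IsArrowOf ε p) :
    arrowClass I ε * prefixClass I p x = 0 := by
  obtain ⟨s, hs⟩ := exists_factor_of_isIrreducibleHom hΓ hI hp h₀ hx₀ hab hirr 0
    (fun m _ => zero_smul _ m)
  obtain ⟨k, hk⟩ := exists_arrowClass_smul_eq hΓ hI hp h₀ ε (prefixClass I p x • x₀)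
  obtain ⟨d, hd, -⟩ := hs (arrowClass I ε * prefixClass I p x - k • prefixClass I p y)
    (by rw [sub_mul, mul_assoc, prefixClass_mul_nil, smul_mul_assoc, prefixClass_mul_nil])
    (by rw [sub_smul, mul_smul, hk, smul_assoc, sub_self])
  obtain ⟨u, r, hur⟩ := p.exists_eq_comp_of_mem_vertices hx
  -- F represents the right subpath ending in y; were that subpath εu, ε would be an arrow of p.
  obtain ⟨F, hF, hF0⟩ : ∃ F : PathAlgebra K Γ,
      I.ringCon.mk' F = prefixClass I p y ∧ F a y (u.cons ε) = 0 := by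
    by_cases hy : y ∈ p.vertices
    · obtain ⟨u', r', h'⟩ := p.exists_eq_comp_of_mem_vertices hy
      refine ⟨ofPath K u', (prefixClass_eq I hΓ h').symm, ofPath_apply_of_ne ?_⟩
      rintro rfl
      exact hε ⟨u, r', h'⟩
    · exact ⟨0, by rw [prefixClass_of_notMem I hy, map_zero], rfl⟩
  obtain ⟨f, rfl⟩ := boundQuiver_mk_surjective d
  by_contra hne
  rw [prefixClass_eq I hΓ hur, arrowClass_mul_pathClass] at hd hne
  have h0 : I.ringCon.mk' (ofPath K (u.cons ε) - k • F - f * ofPath K p) = 0 := by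
    rw [map_sub, map_sub, boundQuiver_mk_smul, hF, map_mul, sub_eq_zero]
    exact hd
  have h1 := hmon.apply_eq_zero h0 hne
  -- If εu began with p, then either εu = p and ε is an arrow of p, or u already begins with p and x
  -- = b.
  have h2 : (f * ofPath K p) a y (u.cons ε) = 0 := by
    by_contra h
    obtain ⟨q, hq⟩ := exists_of_mul_ofPath_apply_ne_zero h
    cases q with
    | nil => exact hε ⟨u, Path.nil, hq.symm⟩
    | cons q e =>
      rw [Path.comp_cons] at hq
      obtain rfl := Path.obj_eq_of_cons_eq_cons hq
      have hl := congrArg Path.length (eq_of_heq (Path.heq_of_cons_eq_cons hq))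
      have hl' := congrArg Path.length hur
      rw [Path.length_comp] at hl hl'
      exact hxb (r.eq_of_length_zero (by omega))
  rw [PathAlgebra.sub_apply, PathAlgebra.sub_apply, PathAlgebra.smul_apply,
    Finsupp.sub_apply, Finsupp.sub_apply, Finsupp.smul_apply, h2, hF0, ofPath_apply_path] at h1
  simp at h1

/-- The relation βp x₀ = 0 gives βp = d p and βp s = d r ε, where r now denotes the left subpath. If
βrε ≠ 0, the first equation forces coefficient 1 for β in d, and the second forces 0. -/
theorem arrowClass_mul_suffixClass_mul_arrowClass_eq_zero_of_isIrreducibleHom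
    (hmon : IsMonomialIdeal I) (hab : a ≠ b)
    (hirr : IsIrreducibleHom (radSubmodule (BoundQuiverAlgebra I) U).subtype)
    {t : Γ} (β : b ⟶ t) (hβ : arrowClass I β * pathClass I p ≠ 0)
    {x y : Γ} (ε : x ⟶ y) (hy : y ∈ p.vertices) (hya : y ≠ a) (hε : ¬ IsArrowOf ε p) :
    arrowClass I β * suffixClass I p y * arrowClass I ε = 0 := by
  have hA : ∀ (x y : Γ) (ε : x ⟶ y), x ∈ p.vertices → x ≠ b → ¬ IsArrowOf ε p →
      arrowClass I ε * prefixClass I p x = 0 := fun x y ε hx hxb hε =>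
    arrowClass_mul_prefixClass_eq_zero_of_isIrreducibleHom hΓ hI hp h₀ hx₀ hmon hab hirr
      ε hx hxb hε
  obtain ⟨s, hs⟩ := exists_factor_of_isIrreducibleHom hΓ hI hp h₀ hx₀ hab hirr
    (suffixClass I p y * arrowClass I ε) fun m _ => by
      rw [mul_smul, arrowClass_smul_eq_zero_of_not_isArrowOf hΓ hI hp h₀ hA ε hε, smul_zero]
  obtain ⟨d, hd, hd'⟩ := hs (arrowClass I β * pathClass I p)
    (by rw [mul_assoc, pathClass_mul, Path.nil_comp])
    (by rw [mul_smul]; exact arrowClass_smul_pathClass_smul_eq_zero hΓ hI hp h₀ β)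
  obtain ⟨u, r, hur⟩ := p.exists_eq_comp_of_mem_vertices hy
  rw [suffixClass_eq I hΓ hur, pathClass_mul_arrowClass] at hd'
  rw [suffixClass_eq I hΓ hur, mul_assoc, pathClass_mul_arrowClass, arrowClass_mul_pathClass]
  rw [arrowClass_mul_pathClass] at hd hβ hd'
  obtain ⟨f, rfl⟩ := boundQuiver_mk_surjective d
  obtain ⟨g, rfl⟩ := boundQuiver_mk_surjective s
  by_contra hne
  have h0 : I.ringCon.mk' (ofPath K (p.cons β) - f * ofPath K p) = 0 := by
    rw [map_sub, map_mul, sub_eq_zero]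
    exact hd
  have h1 : I.ringCon.mk' (ofPath K (p.cons β) * g - f * ofPath K (ε.toPath.comp r)) = 0 := by
    rw [map_sub, map_mul, map_mul, sub_eq_zero]
    exact hd'
  have h2 := hmon.apply_eq_zero h0 hβ
  have h3 := hmon.apply_eq_zero h1 hne
  -- A path occurring here is βp preceded by some q. Equality with βrε would give ε = uq with u
  -- nontrivial, so u = ε and ε would be the first arrow of p.
  have h4 : (ofPath K (p.cons β) * g) x t ((ε.toPath.comp r).cons β) = 0 := by
    by_contra h
    obtain ⟨q, hq⟩ := exists_of_ofPath_mul_apply_ne_zero h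
    change (ε.toPath.comp r).cons β = (q.comp p).cons β at hq
    have hq' := eq_of_heq (Path.heq_of_cons_eq_cons hq)
    rw [hur, ← Path.comp_assoc, Path.comp_inj_left] at hq'
    cases u with
    | nil => exact hya rfl
    | cons u e =>
      have hl := congrArg Path.length hq'
      simp only [Path.length_toPath, Path.length_comp, Path.length_cons] at hl
      obtain rfl := u.eq_of_length_zero (by omega)
      obtain rfl := q.eq_of_length_zero (by omega)
      obtain rfl := q.eq_nil_of_length_zero (by omega)
      obtain rfl := u.eq_nil_of_length_zero (by omega)
      obtain rfl := eq_of_heq (Path.hom_heq_of_cons_eq_cons hq')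
      exact hε ⟨Path.nil, r, hur⟩
  have h5 : p.cons β = p.comp β.toPath := rfl
  have h6 : (ε.toPath.comp r).cons β = (ε.toPath.comp r).comp β.toPath := rfl
  rw [PathAlgebra.sub_apply, Finsupp.sub_apply, ofPath_apply_path, h5, mul_ofPath_apply_comp] at h2
  rw [PathAlgebra.sub_apply, Finsupp.sub_apply, h4, h6, mul_ofPath_apply_comp, zero_sub,
    neg_eq_zero] at h3
  rw [h3, sub_zero] at h2
  exact one_ne_zero h2

end Necessity

/-! ### Sufficiency of the conditions -/

section Sufficiency

variable {K : Type u} {Γ : Type v} [Field K] [Quiver.{w} Γ] [DecidableEq Γ] [Fintype Γ]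
  {I : TwoSidedIdeal (PathAlgebra K Γ)} {a b : Γ} {p : Path a b}
  {U : Type x} [AddCommGroup U] [Module (BoundQuiverAlgebra I) U]
  [Module K U] [IsScalarTower K (BoundQuiverAlgebra I) U]
  {V : Type x} [AddCommGroup V] [Module (BoundQuiverAlgebra I) V]
  [Module K V] [IsScalarTower K (BoundQuiverAlgebra I) V]
  (hΓ : IsTriangularQuiver Γ) (hI : IsAdmissibleIdeal I) (hp : IsMast I U p) {x₀ : U}
  (h₀ : pathClass I p • x₀ ≠ 0) (hx₀ : pathClass I (Path.nil : Path a a) • x₀ = x₀)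
  (hA : ∀ (x y : Γ) (ε : x ⟶ y), x ∈ p.vertices → x ≠ b → ¬ IsArrowOf ε p →
    arrowClass I ε * prefixClass I p x = 0)
include hΓ hI hp h₀ hx₀ hA

/-- If the arrows off the mast `p` annihilate its right subpaths, then `U` is presented by a
generator at the first vertex of `p` and the relations `β p = 0`, for the arrows `β` starting in
the last vertex of `p`. -/
theorem exists_linearMap_of_arrowClass_smul_eq_zero {v₁ : V}
    (hv₁ : pathClass I (Path.nil : Path a a) • v₁ = v₁)
    (hβ : ∀ (t : Γ) (β : b ⟶ t), arrowClass I β • pathClass I p • v₁ = 0) :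
    ∃ σ : U →ₗ[BoundQuiverAlgebra I] V, σ x₀ = v₁ := by
  let σ : U →ₗ[K] V := (mastBasis hΓ hI hp h₀).constr K fun v => prefixClass I p v • v₁
  have hσ : ∀ v, σ (prefixClass I p v • x₀) = prefixClass I p v • v₁ := fun v => by
    by_cases hv : v ∈ p.vertices
    · have := (mastBasis hΓ hI hp h₀).constr_basis K (fun v => prefixClass I p v • v₁) ⟨v, hv⟩
      rwa [mastBasis_apply] at this
    · rw [prefixClass_of_notMem I hv, zero_smul, zero_smul, map_zero]
  have hlin : ∀ (c : BoundQuiverAlgebra I) (m : U), σ (c • m) = c • σ m := by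
    refine map_smul_of_map_arrowClass_smul σ (fun v m => ?_) (fun v w α m => ?_)
    · induction m using mast_induction (K := K) hΓ hI hp h₀ with
      | zero => simp
      | add y z hy hz => rw [smul_add, map_add, map_add, smul_add, hy, hz]
      | smul k y hy => rw [smul_comm, σ.map_smul, σ.map_smul, hy, smul_comm]
      | basis x hx =>
        rw [hσ, ← mul_smul, ← mul_smul]
        by_cases h : x = v
        · subst h
          rw [nil_mul_prefixClass, hσ]
        · rw [pathClass_mul_prefixClass_of_ne _ _ h, zero_smul, zero_smul, map_zero]
    · induction m using mast_induction (K := K) hΓ hI hp h₀ with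
      | zero => simp
      | add y z hy hz => rw [smul_add, map_add, map_add, smul_add, hy, hz]
      | smul k y hy => rw [smul_comm, σ.map_smul, σ.map_smul, hy, smul_comm]
      | basis x hx =>
        by_cases h : x = v
        · subst h
          -- An arrow off the mast kills U; the corresponding product with v₁ vanishes by `hβ` at b
          -- and by `hA` elsewhere.
          by_cases hα : IsArrowOf α p
          · rw [hσ, ← mul_smul, ← mul_smul, hα.arrowClass_mul_prefixClass I hΓ, hσ]
          · rw [arrowClass_smul_eq_zero_of_not_isArrowOf hΓ hI hp h₀ hA α hα, hσ, map_zero]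
            by_cases hb : x = b
            · subst hb
              rw [prefixClass_target I hΓ, hβ]
            · rw [← mul_smul, hA _ _ α hx hb hα, zero_smul]
        · rw [hσ, ← mul_smul, ← mul_smul, arrowClass, pathClass_mul_prefixClass_of_ne _ _ h,
            zero_smul, zero_smul, map_zero]
  refine ⟨{ toFun := σ, map_add' := map_add σ, map_smul' := hlin }, ?_⟩
  have := hσ a
  rwa [prefixClass_source I hΓ, hx₀, hv₁] at this

omit hx₀ in
/-- A functional on `V` vanishing on `pV` and on `r ε V`, for the arrows `ε` off the mast `p`
followed by a proper left subpath `r` of `p`, induces a homomorphism to the radical of `U`. -/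
theorem exists_linearMap_of_functional (φ : V →ₗ[K] K)
    (hφp : ∀ m : V, φ (pathClass I p • m) = 0)
    (hφ : ∀ (x y : Γ) (ε : x ⟶ y), y ∈ p.vertices → y ≠ a → ¬ IsArrowOf ε p → ∀ m : V,
      φ ((suffixClass I p y * arrowClass I ε) • m) = 0) :
    ∃ ρ : V →ₗ[BoundQuiverAlgebra I] radSubmodule (BoundQuiverAlgebra I) U,
      ∀ (v : Γ), v ≠ a → ∀ m : V, pathClass I (Path.nil : Path v v) • m = m →
        (ρ m : U) = φ (suffixClass I p v • m) • prefixClass I p v • x₀ := by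
  -- The coefficient at v is read off by transporting m along p to b. Omitting a keeps the image in
  -- JU; the condition on pV restores compatibility with the arrow of p leaving a.
  let ρ : V →ₗ[K] U := ∑ v ∈ Finset.univ.erase a,
    LinearMap.smulRight (φ ∘ₗ DistribSMul.toLinearMap K V (suffixClass I p v))
      (prefixClass I p v • x₀)
  have hρ : ∀ m, ρ m = ∑ v ∈ Finset.univ.erase a,
      φ (suffixClass I p v • m) • prefixClass I p v • x₀ := fun m => by
    simp [ρ, LinearMap.sum_apply]
  have hρl : ∀ (c w : Γ) (q : Path c w) (m : V), ρ (pathClass I q • m)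
      = if w = a then 0 else
        φ (suffixClass I p w • pathClass I q • m) • prefixClass I p w • x₀ := by
    intro c w q m
    have hz : ∀ v, v ≠ w →
        φ (suffixClass I p v • pathClass I q • m) • prefixClass I p v • x₀ = 0 := fun v hv => by
      rw [← mul_smul, suffixClass_mul_pathClass_of_ne I q hv.symm, zero_smul, map_zero, zero_smul]
    rw [hρ]
    split_ifs with hw
    · exact Finset.sum_eq_zero fun v hv => hz v (hw ▸ (Finset.mem_erase.1 hv).1)
    · exact Finset.sum_eq_single w (fun v _ hv => hz v hv)
        fun h => absurd (Finset.mem_erase.2 ⟨hw, Finset.mem_univ _⟩) h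
  have hρr : ∀ (v w : Γ) (q : Path v w) (m : V), pathClass I q • ρ m
      = if v = a then 0 else
        φ (suffixClass I p v • m) • (pathClass I q * prefixClass I p v) • x₀ := by
    intro v w q m
    have hz : ∀ v', v' ≠ v →
        pathClass I q • φ (suffixClass I p v' • m) • prefixClass I p v' • x₀ = 0 :=
      fun v' hv' => by
        rw [smul_comm, ← mul_smul, pathClass_mul_prefixClass_of_ne I q hv', zero_smul, smul_zero]
    rw [hρ, Finset.smul_sum]
    split_ifs with hv
    · exact Finset.sum_eq_zero fun v' hv' => hz v' (hv ▸ (Finset.mem_erase.1 hv').1)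
    · rw [Finset.sum_eq_single v (fun v' _ hv' => hz v' hv')
        fun h => absurd (Finset.mem_erase.2 ⟨hv, Finset.mem_univ _⟩) h, smul_comm, ← mul_smul]
  have hlin : ∀ (c : BoundQuiverAlgebra I) (m : V), ρ (c • m) = c • ρ m := by
    refine map_smul_of_map_arrowClass_smul ρ (fun v m => ?_) (fun v w α m => ?_)
    · rw [hρl, hρr, ← mul_smul, suffixClass_mul_nil, nil_mul_prefixClass]
    · rw [arrowClass, hρl, hρr, ← mul_smul]
      change (if w = a then 0 else φ ((suffixClass I p w * arrowClass I α) • m) • _)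
        = if v = a then 0 else _ • (arrowClass I α * prefixClass I p v) • x₀
      by_cases hα : IsArrowOf α p
      · rw [if_neg (hα.target_ne hΓ), hα.suffixClass_mul_arrowClass I hΓ,
          hα.arrowClass_mul_prefixClass I hΓ]
        split_ifs with hv
        · subst hv
          rw [suffixClass_source I hΓ, hφp, zero_smul]
        · rfl
      · rw [mul_smul (arrowClass I α),
          arrowClass_smul_eq_zero_of_not_isArrowOf hΓ hI hp h₀ hA α hα, smul_zero, ite_self]
        split_ifs with hw
        · rfl
        · by_cases hmem : w ∈ p.vertices
          · rw [hφ _ _ α hmem hw hα, zero_smul]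
          · rw [prefixClass_of_notMem I hmem, zero_smul, smul_zero]
  let ρ' : V →ₗ[BoundQuiverAlgebra I] U :=
    { toFun := ρ, map_add' := map_add ρ, map_smul' := hlin }
  refine ⟨ρ'.codRestrict _ fun m => ?_, fun v hv m hm => ?_⟩
  · change ρ m ∈ _
    rw [hρ]
    refine Submodule.sum_mem _ fun v hv => ?_
    rw [← algebraMap_smul (BoundQuiverAlgebra I)]
    exact Submodule.smul_mem _ _
      (prefixClass_smul_mem_radSubmodule hΓ hI (Finset.mem_erase.1 hv).1 x₀)
  · change ρ m = _
    have := hρl v v Path.nil m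
    rwa [hm, if_neg hv] at this

omit [Module K V] [IsScalarTower K (BoundQuiverAlgebra I) V] in
-- The position of z = g(p x₀) relative to pV + N decides which map splits.
theorem isSplitMonoHom_or_isSplitEpiHom [Module.Finite (BoundQuiverAlgebra I) U]
    (hB : ∀ (t : Γ) (β : b ⟶ t), arrowClass I β * pathClass I p ≠ 0 →
      ∀ (x y : Γ) (ε : x ⟶ y), y ∈ p.vertices → y ≠ a → ¬ IsArrowOf ε p →
        arrowClass I β * suffixClass I p y * arrowClass I ε = 0) (hab : a ≠ b)
    (g : radSubmodule (BoundQuiverAlgebra I) U →ₗ[BoundQuiverAlgebra I] V)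
    (h : V →ₗ[BoundQuiverAlgebra I] U)
    (hhg : h ∘ₗ g = (radSubmodule (BoundQuiverAlgebra I) U).subtype) :
    IsSplitMonoHom g ∨ IsSplitEpiHom h := by
  let _ : Module K V := Module.compHom V (algebraMap K (BoundQuiverAlgebra I))
  have : IsScalarTower K (BoundQuiverAlgebra I) V :=
    IsScalarTower.of_algebraMap_smul fun _ _ => rfl
  have hmem : ∀ v : Γ, v ≠ a →
      prefixClass I p v • x₀ ∈ radSubmodule (BoundQuiverAlgebra I) U :=
    fun v hv => prefixClass_smul_mem_radSubmodule hΓ hI hv x₀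
  have hg : ∀ n, h (g n) = n := fun n => LinearMap.congr_fun hhg n
  let N : Submodule K V := Submodule.span K {m | ∃ (x y : Γ) (ε : x ⟶ y) (m' : V),
    y ∈ p.vertices ∧ y ≠ a ∧ ¬ IsArrowOf ε p ∧ m = (suffixClass I p y * arrowClass I ε) • m'}
  -- h kills N because off-mast arrows kill U; the arrows β with βp ≠ 0 kill N by `hB`.
  have hN : ∀ m ∈ N, h m = 0 ∧ ∀ (t : Γ) (β : b ⟶ t), arrowClass I β * pathClass I p ≠ 0 →
      arrowClass I β • m = 0 := by
    intro m hm
    induction hm using Submodule.span_induction with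
    | mem m hm =>
      obtain ⟨x, y, ε, m', hy, hya, hε, rfl⟩ := hm
      refine ⟨?_, fun t β hβ => ?_⟩
      · rw [map_smul, mul_smul,
          arrowClass_smul_eq_zero_of_not_isArrowOf hΓ hI hp h₀ hA ε hε, smul_zero]
      · rw [← mul_smul, ← mul_assoc, hB t β hβ x y ε hy hya hε, zero_smul]
    | zero => exact ⟨map_zero _, fun _ _ _ => smul_zero _⟩
    | add m n _ _ hm hn =>
      refine ⟨by rw [map_add, hm.1, hn.1, add_zero], fun t β hβ => ?_⟩
      rw [smul_add, hm.2 t β hβ, hn.2 t β hβ, add_zero]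
    | smul k m _ hm =>
      refine ⟨?_, fun t β hβ => by rw [smul_comm, hm.2 t β hβ, smul_zero]⟩
      rw [← algebraMap_smul (BoundQuiverAlgebra I), map_smul, hm.1, smul_zero]
  let P : Submodule K V := LinearMap.range (DistribSMul.toLinearMap K V (pathClass I p))
  let z : V := g ⟨_, hmem b hab.symm⟩
  by_cases hz : z ∈ P ⊔ N
  · right
    obtain ⟨_, ⟨v₁, rfl⟩, n, hn, hsum⟩ := Submodule.mem_sup.1 hz
    change pathClass I p • v₁ + n = z at hsum
    have hpe : ∀ m : V, pathClass I p • pathClass I (Path.nil : Path a a) • m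
        = pathClass I p • m := fun m => by rw [pathClass_smul_smul, Path.nil_comp]
    have hhv : pathClass I p • h v₁ = pathClass I p • x₀ := by
      have := congrArg h hsum
      rw [map_add, (hN n hn).1, add_zero, map_smul] at this
      rw [this, hg]
      change prefixClass I p b • x₀ = _
      rw [prefixClass_target I hΓ]
    obtain ⟨σ, hσ⟩ := exists_linearMap_of_arrowClass_smul_eq_zero hΓ hI hp h₀ hx₀ hA
      (v₁ := pathClass I (Path.nil : Path a a) • v₁)
      (by rw [pathClass_smul_smul, Path.comp_nil]) (fun t β => by
        rw [hpe]
        by_cases hβ : arrowClass I β * pathClass I p = 0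
        · rw [← mul_smul, hβ, zero_smul]
        · have h1 : arrowClass I β • z = 0 := by
            rw [← map_smul]
            convert map_zero g
            refine Subtype.ext ?_
            change arrowClass I β • prefixClass I p b • x₀ = 0
            rw [prefixClass_target I hΓ]
            exact arrowClass_smul_pathClass_smul_eq_zero hΓ hI hp h₀ β
          rwa [← hsum, smul_add, (hN n hn).2 t β hβ, add_zero] at h1)
    refine ⟨σ, ?_⟩
    have hx : h (σ x₀) = x₀ := by
      rw [hσ, map_smul]
      obtain ⟨k, hk⟩ := exists_nil_smul_eq hΓ hI hp h₀ a (h v₁)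
      rw [prefixClass_source I hΓ, hx₀] at hk
      -- Multiplying h(e v₁) = k x₀ by p, where e is the trivial path at a, and comparing with p
      -- h(v₁) = p x₀ gives k = 1.
      have h1 : k • pathClass I p • x₀ = (1 : K) • pathClass I p • x₀ := by
        rw [one_smul, smul_comm, ← hk, pathClass_smul_smul, Path.nil_comp, hhv]
      rw [hk, smul_left_injective K h₀ h1, one_smul]
    refine LinearMap.ext_on (span_generator_eq_top hΓ hI hp h₀) ?_
    rintro _ rfl
    exact hx
  · left
    obtain ⟨φ, hφz, hφ⟩ := Submodule.exists_le_ker_of_notMem hz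
    -- The functional is normalized to take the value 1 at z.
    obtain ⟨ρ, hρ⟩ := exists_linearMap_of_functional hΓ hI hp h₀ hA ((φ z)⁻¹ • φ)
      (fun m => by
        have : φ (pathClass I p • m) = 0 := hφ (Submodule.mem_sup_left ⟨m, rfl⟩)
        rw [LinearMap.smul_apply, this, smul_zero])
      (fun x y ε hy hya hε m => by
        have : φ ((suffixClass I p y * arrowClass I ε) • m) = 0 := hφ
          (Submodule.mem_sup_right (Submodule.subset_span ⟨x, y, ε, m, hy, hya, hε, rfl⟩))
        rw [LinearMap.smul_apply, this, smul_zero])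
    refine ⟨ρ, ?_⟩
    -- Transport along p sends the image under g of each basis vector of JU to the same z, so ρ
    -- recovers that vector with coefficient 1.
    have key : ∀ (v : Γ) (hv : v ≠ a), ρ (g ⟨_, hmem v hv⟩) = ⟨_, hmem v hv⟩ := fun v hv => by
      refine Subtype.ext ?_
      by_cases hvp : v ∈ p.vertices
      · have h1 : suffixClass I p v • g ⟨_, hmem v hv⟩ = z := by
          rw [← map_smul]
          refine congrArg g (Subtype.ext ?_)
          change suffixClass I p v • prefixClass I p v • x₀ = prefixClass I p b • x₀
          rw [← mul_smul, suffixClass_mul_prefixClass I hΓ hvp, prefixClass_target I hΓ]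
        rw [hρ v hv, h1, LinearMap.smul_apply, smul_eq_mul, inv_mul_cancel₀ hφz, one_smul]
        rw [← map_smul]
        refine congrArg g (Subtype.ext ?_)
        change pathClass I _ • prefixClass I p v • x₀ = prefixClass I p v • x₀
        rw [← mul_smul, nil_mul_prefixClass]
      · have h1 : (⟨_, hmem v hv⟩ : radSubmodule (BoundQuiverAlgebra I) U) = 0 :=
          Subtype.ext (by
            change prefixClass I p v • x₀ = 0
            rw [prefixClass_of_notMem I hvp, zero_smul])
        rw [h1, map_zero, map_zero]
    refine LinearMap.ext fun n => ?_
    change ρ (g n) = n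
    rw [← sum_pathClass_nil_smul (I := I) n, map_sum, map_sum]
    refine Finset.sum_congr rfl fun v _ => ?_
    by_cases hv : v = a
    · subst hv
      have h1 : pathClass I (Path.nil : Path v v) • n = 0 := Subtype.ext
        (nil_smul_eq_zero_of_mem_radSubmodule hΓ hI hp h₀ hx₀ n.2)
      rw [h1, map_zero, map_zero]
    · obtain ⟨k, hk⟩ := exists_nil_smul_eq hΓ hI hp h₀ v (n : U)
      have h1 : pathClass I (Path.nil : Path v v) • n
          = algebraMap K (BoundQuiverAlgebra I) k • ⟨_, hmem v hv⟩ := Subtype.ext (by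
        rw [Submodule.coe_smul, Submodule.coe_smul, hk, algebraMap_smul])
      rw [h1, map_smul, map_smul, key v hv]

end Sufficiency

/-! ### The equivalence -/

theorem mainTheorem3 {K : Type u} [Field K]
    {Γ : Type v} [Quiver.{w} Γ] [Fintype Γ] [DecidableEq Γ] [∀ a b : Γ, Finite (a ⟶ b)]
    (hΓ : IsTriangularQuiver Γ)
    (I : TwoSidedIdeal (PathAlgebra K Γ)) (hadm : IsAdmissibleIdeal I) (hmon : IsMonomialIdeal I)
    (U : Type (max u v w)) [AddCommGroup U] [Module (BoundQuiverAlgebra I) U]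
    [Module.Finite (BoundQuiverAlgebra I) U] (hU : IsUniserialModule (BoundQuiverAlgebra I) U)
    {a b : Γ} (p : Quiver.Path a b) (hp : IsMast I U p) :
    IsIrreducibleHom (radSubmodule (BoundQuiverAlgebra I) U).subtype ↔
      ¬ IsSimpleModule (BoundQuiverAlgebra I) U ∧
      ((∀ (x y : Γ) (β : x ⟶ y), IsB p β →
          ∀ u : Quiver.Path a x, IsRightSubpath u p →
            arrowClass I β * pathClass I u = 0) ∧
        (∀ (x y : Γ) (δ : x ⟶ y), IsD p δ →
          ∀ u : Quiver.Path a x, IsRightSubpath u p →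
            arrowClass I δ * pathClass I u = 0)) ∧
      (∀ (z t : Γ) (β' : z ⟶ t), IsB' p β' → arrowClass I β' * pathClass I p ≠ 0 →
        (∀ (x y : Γ) (γ : x ⟶ y), IsC p γ →
          ∀ r : Quiver.Path y b, IsLeftSubpath r p →
            arrowClass I β' * pathClass I r * arrowClass I γ = 0) ∧
        (∀ (x y : Γ) (δ : x ⟶ y), IsD p δ →
          ∀ r : Quiver.Path y b, IsLeftSubpath r p →
            arrowClass I β' * pathClass I r * arrowClass I δ = 0)) := by
  let _ : Module K U := Module.compHom U (algebraMap K (BoundQuiverAlgebra I))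
  have : IsScalarTower K (BoundQuiverAlgebra I) U :=
    IsScalarTower.of_algebraMap_smul fun _ _ => rfl
  obtain ⟨x, hx⟩ := hp.2
  obtain ⟨x₀, h₀, hx₀⟩ : ∃ x₀ : U, pathClass I p • x₀ ≠ 0 ∧
      pathClass I (Path.nil : Path a a) • x₀ = x₀ :=
    ⟨pathClass I (Path.nil : Path a a) • x, by rwa [pathClass_smul_smul, Path.nil_comp],
      by rw [pathClass_smul_smul, Path.nil_comp]⟩
  have hnt : Nontrivial U := ⟨⟨_, _, hx⟩⟩
  have hlt : radSubmodule (BoundQuiverAlgebra I) U < ⊤ := Submodule.jacobson_smul_lt_top ⊤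
  -- If a = b, the mast is trivial and U has length 1.
  have hsimple : ¬ IsSimpleModule (BoundQuiverAlgebra I) U → a ≠ b := by
    rintro h rfl
    refine h (Module.length_eq_one_iff.1 ?_)
    rw [hp.1, hΓ a p]
    simp
  constructor
  · intro hirr
    have hns : ¬ IsSimpleModule (BoundQuiverAlgebra I) U := by
      intro hs
      have hbot : radSubmodule (BoundQuiverAlgebra I) U = ⊥ :=
        (eq_bot_or_eq_top _).resolve_right hlt.ne
      refine hirr.1 ⟨0, LinearMap.ext fun n => Subtype.ext ?_⟩
      exact ((Submodule.mem_bot (BoundQuiverAlgebra I)).1 (hbot ▸ n.2)).symm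
    have hab := hsimple hns
    have hA := fun (x y : Γ) (ε : x ⟶ y) =>
      arrowClass_mul_prefixClass_eq_zero_of_isIrreducibleHom hΓ hadm hp h₀ hx₀ hmon hab hirr ε
    refine ⟨hns, ⟨?_, ?_⟩, ?_⟩
    · rintro x y β ⟨hx, hxb, hy⟩ u ⟨r, hur⟩
      rw [← prefixClass_eq I hΓ hur]
      exact hA x y β hx hxb fun h => hy h.target_mem
    · rintro x y δ ⟨hx, hy, hδ⟩ u ⟨r, hur⟩
      rw [← prefixClass_eq I hΓ hur]
      refine hA x y δ hx ?_ hδ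
      rintro rfl
      obtain ⟨_, r, -⟩ := p.exists_eq_comp_of_mem_vertices hy
      exact hΓ.isEmpty_path_of_hom δ r
    · rintro z t β' hz hβ'
      obtain rfl : z = b := hz
      have hB := fun (x y : Γ) (ε : x ⟶ y) =>
        arrowClass_mul_suffixClass_mul_arrowClass_eq_zero_of_isIrreducibleHom hΓ hadm hp h₀ hx₀
          hmon hab hirr β' hβ' ε
      refine ⟨?_, ?_⟩
      · rintro x y γ ⟨hx, hy, hya⟩ r ⟨u, hur⟩
        rw [← suffixClass_eq I hΓ hur]
        refine hB x y γ hy hya ?_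
        rintro ⟨u', r', h'⟩
        refine hx (Path.mem_vertices_of_eq_comp (u := u') (r := γ.toPath.comp r') ?_)
        rw [h', ← Path.comp_assoc, Path.comp_toPath_eq_cons]
      · rintro x y δ ⟨hx, hy, hδ⟩ r ⟨u, hur⟩
        rw [← suffixClass_eq I hΓ hur]
        refine hB x y δ hy ?_ hδ
        rintro rfl
        obtain ⟨u', -, -⟩ := p.exists_eq_comp_of_mem_vertices hx
        exact hΓ.isEmpty_path_of_hom δ u'
  · rintro ⟨hns, ⟨hab₁, had⟩, hb⟩
    have hab := hsimple hns
    -- B and D together cover the arrows off the mast starting at a vertex of p other than b;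
    -- dually, C and D cover those ending at a vertex other than a.
    have hA : ∀ (x y : Γ) (ε : x ⟶ y), x ∈ p.vertices → x ≠ b → ¬ IsArrowOf ε p →
        arrowClass I ε * prefixClass I p x = 0 := by
      intro x y ε hx hxb hε
      obtain ⟨u, r, hur⟩ := p.exists_eq_comp_of_mem_vertices hx
      rw [prefixClass_eq I hΓ hur]
      by_cases hy : y ∈ p.vertices
      · exact had x y ε ⟨hx, hy, hε⟩ u ⟨r, hur⟩
      · exact hab₁ x y ε ⟨hx, hxb, hy⟩ u ⟨r, hur⟩
    have hB : ∀ (t : Γ) (β : b ⟶ t), arrowClass I β * pathClass I p ≠ 0 →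
        ∀ (x y : Γ) (ε : x ⟶ y), y ∈ p.vertices → y ≠ a → ¬ IsArrowOf ε p →
          arrowClass I β * suffixClass I p y * arrowClass I ε = 0 := by
      intro t β hβ x y ε hy hya hε
      obtain ⟨u, r, hur⟩ := p.exists_eq_comp_of_mem_vertices hy
      rw [suffixClass_eq I hΓ hur]
      by_cases hx : x ∈ p.vertices
      · exact (hb b t β rfl hβ).2 x y ε ⟨hx, hy, hε⟩ r ⟨u, hur⟩
      · exact (hb b t β rfl hβ).1 x y ε ⟨hx, hy, hya⟩ r ⟨u, hur⟩
    refine ⟨?_, ?_, ?_⟩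
    · rintro ⟨g, hg⟩
      -- A retraction maps x₀ to the component of JU at a, which is zero, and so annihilates p x₀.
      have hgx : g x₀ = 0 := by
        rw [← hx₀, map_smul]
        exact Subtype.ext (nil_smul_eq_zero_of_mem_radSubmodule hΓ hadm hp h₀ hx₀ (g x₀).2)
      have hmem : pathClass I p • x₀ ∈ radSubmodule (BoundQuiverAlgebra I) U := by
        rw [← prefixClass_target I hΓ]
        exact prefixClass_smul_mem_radSubmodule hΓ hadm hab.symm x₀
      have h1 : g (pathClass I p • x₀) = ⟨_, hmem⟩ := LinearMap.congr_fun hg ⟨_, hmem⟩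
      rw [map_smul, hgx, smul_zero] at h1
      exact h₀ (congrArg Subtype.val h1).symm
    · rintro ⟨g, hg⟩
      refine hlt.ne (eq_top_iff.2 fun y _ => ?_)
      have h1 : ((g y : radSubmodule (BoundQuiverAlgebra I) U) : U) = y :=
        LinearMap.congr_fun hg y
      rw [← h1]
      exact (g y).2
    · intro V _ _ _ g h hhg
      exact isSplitMonoHom_or_isSplitEpiHom hΓ hadm hp h₀ hx₀ hA hB hab g h hhg
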